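/- Let $\mathbb D=\{z\in\mathbb C:|z|<1\}$, $\mathbb D^*=\mathbb D\setminus\{0\}$, and let $dV$ be Lebesgue measure on $\mathbb C^2$. For an open set $U\subseteq\mathbb C^2$ let $A^p(U)$ be the space of functions in $L^p(U)$ that are holomorphic on $U$, with the $L^p$ norm; $A^2(U)$ is closed in $L^2(U)$, and the Bergman projection $\mathbf B_U$ is the orthogonal projection of $L^2(U)$ onto $A^2(U)$. Let $L^p(\mathbb D^*\times\mathbb D,|w_1|^{2-p})$ be the space of functions $f$ on $\mathbb D^*\times\mathbb D$ with $\|f\|^p=\int_{\mathbb D^*\times\mathbb D}|f|^p\,|w_1|^{2-p}\,dV<\infty$. **Proposition.** Let $2\le p<\infty$. Then $L^p(\mathbb D^*\times\mathbb D,|w_1|^{2-p})\subseteq L^2(\mathbb D^*\times\mathbb D)$, and the Bergman projection $\mathbf B_{\mathbb D^*\times\mathbb D}$ restricts to a bounded and surjective linear operator from $L^p(\mathbb D^*\times\mathbb D,|w_1|^{2-p})$ onto $A^p(\mathbb D^*\times\mathbb D)$. Moreover: 1. $A^p(\mathbb D^*\times\mathbb D)=A^p(\mathbb D^2)$: restriction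 of functions from $\mathbb D^2$ to $\mathbb D^*\times\mathbb D$ is an isometric isomorphism of $A^p(\mathbb D^2)$ onto $A^p(\mathbb D^*\times\mathbb D)$. 2. There is a bounded linear operator $T:A^p(\mathbb D^2)\to A^p(\mathbb D^2)$ which sends $f=\sum_{\mu,\nu\ge0}a_{\mu,\nu}w_1^\mu w_2^\nu$ to $Tf=\sum_{\mu,\nu\ge0}\bigl(1+\tfrac1{\mu+1}\bigr)a_{\mu,\nu}w_1^\mu w_2^\nu$, both series converging absolutely at every point of $\mathbb D^2$. 3. With the identification in 1, $f\mapsto|w_1|^2\cdot Tf$ is a bounded linear operator from $A^p(\mathbb D^*\times\mathbb D)$ to $L^p(\mathbb D^*\times\mathbb D,|w_1|^{2-p})$ and a right inverse of $\mathbf B_{\mathbb D^*\times\mathbb D}$: $\mathbf B_{\mathbb D^*\times\mathbb D}(|w_1|^2\,Tf)=f$ for every $f\in A^p(\mathbb D^*\times\mathbb D)$. -/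

import Mathlib

open MeasureTheory Filter Topology Metric
open scoped ENNReal NNReal

/-- The Bergman space `A^p(U)` of an open set `U ⊆ ℂ²`: the classes in `L^p(U)` (Lebesgue measure)
that have a representative holomorphic on `U`. -/
def bergmanSpace (p : ℝ≥0∞) (U : TopologicalSpace.Opens (ℂ × ℂ)) :
    Submodule ℂ (Lp ℂ p (volume.restrict (U : Set (ℂ × ℂ)))) where
  carrier := {f | ∃ F : ℂ × ℂ → ℂ, DifferentiableOn ℂ F U ∧
    f =ᵐ[volume.restrict (U : Set (ℂ × ℂ))] F}
  zero_mem' := ⟨0, differentiableOn_const _, Lp.coeFn_zero _ _ _⟩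
  add_mem' := by
    rintro f g ⟨F, hF, hfF⟩ ⟨G, hG, hgG⟩
    exact ⟨F + G, hF.add hG, (Lp.coeFn_add f g).trans (hfF.add hgG)⟩
  smul_mem' := by
    rintro c f ⟨F, hF, hfF⟩
    exact ⟨c • F, hF.const_smul c, (Lp.coeFn_smul c f).trans (hfF.const_smul c)⟩

/-! ### `A²(U)` is closed in `L²(U)`

This is what the orthogonal projection onto `A²(U)` needs. The proof is the Bergman inequality
(sub-mean value property on polydiscs) with a Cauchy estimate for the derivatives. -/

theorem circle_enorm_bound {f : ℂ → ℂ} {c : ℂ} {r : ℝ} (hr : 0 < r)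
    (hf : DiffContOnCl ℂ f (ball c r)) :
    ‖f c‖ₑ * volume (Set.Ioo (-Real.pi) Real.pi) ≤
      ∫⁻ θ in Set.Ioo (-Real.pi) Real.pi, ‖f (circleMap c r θ)‖ₑ := by
  have h := DiffContOnCl.circleAverage (f := f) (c := c) (R := r) (by rwa [abs_of_pos hr])
  rw [Real.circleAverage] at h
  have hper : Function.Periodic (fun θ => f (circleMap c r θ)) (2 * Real.pi) := fun θ => by
    simp [periodic_circleMap c r θ]
  have h2 := hper.intervalIntegral_add_eq 0 (-Real.pi)
  rw [zero_add, show -Real.pi + 2 * Real.pi = Real.pi by ring] at h2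
  rw [h2, intervalIntegral.integral_of_le (by linarith [Real.pi_pos]),
    integral_Ioc_eq_integral_Ioo] at h
  have hv : volume (Set.Ioo (-Real.pi) Real.pi) = ENNReal.ofReal (2 * Real.pi) := by
    rw [Real.volume_Ioo]; congr 1; ring
  rw [← h, enorm_smul, hv]
  calc _ = (‖(2 * Real.pi)⁻¹‖ₑ * ENNReal.ofReal (2 * Real.pi)) *
        ‖∫ θ in Set.Ioo (-Real.pi) Real.pi, f (circleMap c r θ)‖ₑ := by ring
    _ = ‖∫ θ in Set.Ioo (-Real.pi) Real.pi, f (circleMap c r θ)‖ₑ := by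
        have hp : 0 < 2 * Real.pi := by positivity
        rw [Real.enorm_eq_ofReal (by positivity), ← ENNReal.ofReal_mul (by positivity),
          inv_mul_cancel₀ hp.ne', ENNReal.ofReal_one, one_mul]
    _ ≤ _ := enorm_integral_le_lintegral_enorm _

theorem disc_enorm_bound {f : ℂ → ℂ} {c : ℂ} {R : ℝ}
    (hf : DifferentiableOn ℂ f (ball c R)) :
    ‖f c‖ₑ * volume (ball c R) ≤ ∫⁻ w in ball c R, ‖f w‖ₑ := by
  have key : ∀ g : ℂ → ℝ≥0∞, Measurable ((ball c R).indicator g) →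
      ∫⁻ w in ball c R, g w = ∫⁻ r in Set.Ioi (0 : ℝ), ENNReal.ofReal r *
        ∫⁻ θ in Set.Ioo (-Real.pi) Real.pi, (ball c R).indicator g (circleMap c r θ) := by
    intro g hg
    rw [← lintegral_indicator measurableSet_ball,
      ← lintegral_add_left_eq_self _ c, ← Complex.lintegral_comp_polarCoord_symm,
      polarCoord_target, Measure.volume_eq_prod, ← Measure.prod_restrict,
      lintegral_prod]
    · refine lintegral_congr fun r => ?_
      rw [← lintegral_const_mul]
      · refine lintegral_congr fun θ => ?_
        simp only [smul_eq_mul]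
        congr 2
        simp [Complex.polarCoord_symm_apply, circleMap, Complex.exp_mul_I]
      · exact hg.comp (continuous_circleMap c r).measurable
    · refine Measurable.aemeasurable ?_
      refine (ENNReal.measurable_ofReal.comp measurable_fst).smul (hg.comp ?_)
      refine measurable_const.add ?_
      change Measurable fun p : ℝ × ℝ => Complex.polarCoord.symm p
      simp_rw [Complex.polarCoord_symm_apply]
      fun_prop
  have hm : Measurable ((ball c R).indicator fun w => ‖f w‖ₑ) := by
    classical
    rw [← Set.piecewise_eq_indicator]
    exact (hf.continuousOn.enorm).measurable_piecewise continuousOn_const measurableSet_ball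
  rw [key _ hm, ← setLIntegral_const, key _ (measurable_const.indicator measurableSet_ball)]
  refine setLIntegral_mono' measurableSet_Ioi fun r hr => ?_
  have hr : 0 < r := hr
  refine mul_le_mul' le_rfl ?_
  by_cases hrR : r < R
  · have hin : ∀ θ, circleMap c r θ ∈ ball c R := fun θ => by
      simp [circleMap, abs_of_pos hr, hrR]
    rw [lintegral_congr fun θ => Set.indicator_of_mem (hin θ) (fun _ => ‖f c‖ₑ),
      lintegral_congr fun θ => Set.indicator_of_mem (hin θ) (fun w => ‖f w‖ₑ), setLIntegral_const]
    refine circle_enorm_bound hr ⟨hf.mono (ball_subset_ball hrR.le), ?_⟩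
    rw [closure_ball _ hr.ne']
    exact hf.continuousOn.mono (closedBall_subset_ball hrR)
  · have hin : ∀ θ, circleMap c r θ ∉ ball c R := fun θ => by
      simp [circleMap, abs_of_pos hr]; linarith
    rw [lintegral_congr fun θ => Set.indicator_of_notMem (hin θ) (fun _ => ‖f c‖ₑ)]
    simp

theorem polydisc_enorm_bound {f : ℂ × ℂ → ℂ} {z : ℂ × ℂ} {R : ℝ}
    (hf : DifferentiableOn ℂ f (ball z R)) :
    ‖f z‖ₑ * volume (ball z R) ≤ ∫⁻ w in ball z R, ‖f w‖ₑ := by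
  have hb : ball z R = ball z.1 R ×ˢ ball z.2 R := by rw [ball_prod_same]
  rw [hb] at hf
  rw [hb, Measure.volume_eq_prod, Measure.prod_prod, ← Measure.prod_restrict, lintegral_prod]
  · rcases le_or_gt R 0 with hR | hR
    · simp [ball_eq_empty.2 hR]
    rw [← mul_assoc]
    have h1 : ‖f z‖ₑ * volume (ball z.1 R) ≤ ∫⁻ x in ball z.1 R, ‖f (x, z.2)‖ₑ :=
      disc_enorm_bound (f := fun x => f (x, z.2)) (hf.comp (by fun_prop)
        fun x hx => ⟨hx, mem_ball_self hR⟩)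
    refine (mul_le_mul_left h1 _).trans ?_
    refine (lintegral_mul_const_le _ _).trans ?_
    refine setLIntegral_mono' measurableSet_ball fun x hx => ?_
    exact disc_enorm_bound (f := fun y => f (x, y)) (hf.comp (by fun_prop) fun y hy => ⟨hx, hy⟩)
  · rw [Measure.prod_restrict]
    exact (hf.continuousOn.aestronglyMeasurable
      (measurableSet_ball.prod measurableSet_ball)).enorm

theorem exists_bergman_bound {R : ℝ} (hR : 0 < R) : ∃ K : ℝ≥0, ∀ (z : ℂ × ℂ) (U : Set (ℂ × ℂ))
    (f : ℂ × ℂ → ℂ), ball z R ⊆ U → DifferentiableOn ℂ f U →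
      ‖f z‖ₑ ≤ K * eLpNorm f 2 (volume.restrict U) := by
  set W := volume (ball (0 : ℂ × ℂ) R)
  have hW0 : W ≠ 0 := (measure_ball_pos _ _ hR).ne'
  have hWt : W ≠ ⊤ := measure_ball_lt_top.ne
  refine ⟨(W ^ ((1 : ℝ) / 2) / W).toNNReal, fun z U f hzU hf => ?_⟩
  have hK : (((W ^ ((1 : ℝ) / 2) / W).toNNReal : ℝ≥0) : ℝ≥0∞) = W ^ ((1 : ℝ) / 2) / W :=
    ENNReal.coe_toNNReal
      (ENNReal.div_ne_top (ENNReal.rpow_ne_top_of_nonneg (by norm_num) hWt) hW0)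
  have : (volume : Measure (ℂ × ℂ)).IsAddHaarMeasure := by
    rw [Measure.volume_eq_prod]; infer_instance
  have hb : volume (ball z R) = W := Measure.addHaar_ball_center _ _ _
  have hfb := hf.mono hzU
  have h1 := polydisc_enorm_bound hfb
  rw [hb] at h1
  have hmeas := hfb.continuousOn.aestronglyMeasurable (μ := volume) measurableSet_ball
  have h2 := eLpNorm_le_eLpNorm_mul_rpow_measure_univ (p := 1) (q := 2) (by norm_num) hmeas
  rw [eLpNorm_one_eq_lintegral_enorm, Measure.restrict_apply_univ, hb] at h2
  have h3 : eLpNorm f 2 (volume.restrict (ball z R)) ≤ eLpNorm f 2 (volume.restrict U) :=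
    eLpNorm_mono_measure _ (Measure.restrict_mono hzU le_rfl)
  rw [hK, mul_comm, ← mul_div_assoc, ENNReal.le_div_iff_mul_le (Or.inl hW0) (Or.inl hWt)]
  refine h1.trans (h2.trans ?_)
  norm_num
  gcongr

theorem fderiv_bound {f : ℂ × ℂ → ℂ} {z : ℂ × ℂ} {R C : ℝ} (hR : 0 < R)
    (hf : DifferentiableOn ℂ f (ball z R)) (hC : ∀ w ∈ ball z R, ‖f w‖ ≤ C) :
    ‖fderiv ℂ f z‖ ≤ C / (R / 2) := by
  have hC0 : 0 ≤ C := (norm_nonneg _).trans (hC z (mem_ball_self hR))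
  refine ContinuousLinearMap.opNorm_le_bound _ (by positivity) fun v => ?_
  rcases eq_or_ne v 0 with rfl | hv
  · simp
  have hv' : 0 < ‖v‖ := norm_pos_iff.2 hv
  have hr : 0 < R / 2 / ‖v‖ := by positivity
  have hmem : ∀ t ∈ closedBall (0 : ℂ) (R / 2 / ‖v‖), z + t • v ∈ ball z R := fun t ht => by
    rw [mem_closedBall_zero_iff, le_div_iff₀ hv'] at ht
    rw [mem_ball, dist_eq_norm, add_sub_cancel_left, norm_smul]
    linarith
  have hd : DifferentiableOn ℂ (fun t : ℂ => f (z + t • v)) (closedBall 0 (R / 2 / ‖v‖)) :=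
    hf.comp (by fun_prop) hmem
  have h1 := Complex.norm_deriv_le_of_forall_mem_sphere_norm_le hr (hd.diffContOnCl_ball subset_rfl)
    fun t ht => hC _ (hmem t (sphere_subset_closedBall ht))
  have hfz : HasFDerivAt f (fderiv ℂ f z) (z + (0 : ℂ) • v) := by
    simpa using ((hf z (mem_ball_self hR)).differentiableAt (ball_mem_nhds z hR)).hasFDerivAt
  have hl : HasDerivAt (fun t : ℂ => z + t • v) v 0 := by
    simpa using ((hasDerivAt_id (0 : ℂ)).smul_const v).const_add z
  have h2 : HasDerivAt (fun t : ℂ => f (z + t • v)) (fderiv ℂ f z v) 0 :=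
    hfz.comp_hasDerivAt (0 : ℂ) hl
  rw [h2.deriv] at h1
  refine h1.trans (le_of_eq ?_)
  field_simp

theorem isClosed_bergmanSpace (U : TopologicalSpace.Opens (ℂ × ℂ)) :
    IsClosed (bergmanSpace 2 U : Set (Lp ℂ 2 (volume.restrict (U : Set (ℂ × ℂ))))) := by
  refine IsSeqClosed.isClosed fun u u' hu hlim => ?_
  choose F hF huF using hu
  have hcau := hlim.cauchySeq
  have hdiff : ∀ R : ℝ, 0 < R → ∃ K : ℝ≥0, ∀ z : ℂ × ℂ, ball z R ⊆ (U : Set (ℂ × ℂ)) →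
      ∀ m n, ‖F m z - F n z‖ ≤ K * dist (u m) (u n) := by
    intro R hR
    obtain ⟨K, hK⟩ := exists_bergman_bound hR
    refine ⟨K, fun z hz m n => ?_⟩
    have h := hK z U (F m - F n) hz ((hF m).sub (hF n))
    rw [← eLpNorm_congr_ae ((huF m).sub (huF n)), ← eLpNorm_congr_ae (Lp.coeFn_sub (u m) (u n)),
      ← Lp.enorm_def] at h
    rw [dist_eq_norm]
    rw [← ofReal_norm, ← ofReal_norm, ← ENNReal.ofReal_coe_nnreal,
      ← ENNReal.ofReal_mul (by positivity)] at h
    exact (ENNReal.ofReal_le_ofReal_iff (by positivity)).1 h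
  have hball : ∀ z ∈ (U : Set (ℂ × ℂ)), ∃ R > 0, ball z R ⊆ (U : Set (ℂ × ℂ)) := fun z hz =>
    Metric.isOpen_iff.1 U.isOpen z hz
  have hconv : ∀ z ∈ (U : Set (ℂ × ℂ)), ∃ l, Tendsto (fun n => F n z) atTop (𝓝 l) := by
    intro z hz
    obtain ⟨R, hR, hzR⟩ := hball z hz
    obtain ⟨K, hK⟩ := hdiff R hR
    refine cauchySeq_tendsto_of_complete (Metric.cauchySeq_iff.2 fun ε hε => ?_)
    obtain ⟨N, hN⟩ := Metric.cauchySeq_iff.1 hcau (ε / (K + 1)) (by positivity)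
    refine ⟨N, fun m hm n hn => ?_⟩
    rw [dist_eq_norm]
    refine (hK z hzR m n).trans_lt ?_
    have h := hN m hm n hn
    rw [lt_div_iff₀ (by positivity)] at h
    nlinarith [dist_nonneg (x := u m) (y := u n)]
  choose! G hG using hconv
  refine ⟨G, fun z hz => ?_, ?_⟩
  · obtain ⟨R, hR, hzR⟩ := hball z hz
    obtain ⟨K, hK⟩ := hdiff (R / 4) (by positivity)
    have hin : ∀ w ∈ ball z (R / 4), ∀ v ∈ ball w (R / 4), ball v (R / 4) ⊆ (U : Set (ℂ × ℂ)) := by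
      intro w hw v hv x hx
      refine hzR ?_
      rw [mem_ball] at *
      linarith [dist_triangle x v z, dist_triangle v w z]
    have hder : ∀ w ∈ ball z (R / 4), ∀ m n, dist (fderiv ℂ (F m) w) (fderiv ℂ (F n) w) ≤
        K * dist (u m) (u n) / (R / 4 / 2) := by
      intro w hw m n
      have hwU : ball w (R / 4) ⊆ (U : Set (ℂ × ℂ)) := hin w hw w (mem_ball_self (by positivity))
      have hwn : (U : Set (ℂ × ℂ)) ∈ 𝓝 w :=
        U.isOpen.mem_nhds (hwU (mem_ball_self (by positivity)))
      rw [dist_eq_norm, ← fderiv_sub ((hF m).differentiableAt hwn) ((hF n).differentiableAt hwn)]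
      exact fderiv_bound (by positivity) (((hF m).sub (hF n)).mono hwU)
        fun v hv => hK v (hin w hw v hv) m n
    have hunif : UniformCauchySeqOn (fun n => fderiv ℂ (F n)) atTop (ball z (R / 4)) := by
      refine Metric.uniformCauchySeqOn_iff.2 fun ε hε => ?_
      obtain ⟨N, hN⟩ := Metric.cauchySeq_iff.1 hcau (ε * (R / 4 / 2) / (K + 1)) (by positivity)
      refine ⟨N, fun m hm n hn w hw => (hder w hw m n).trans_lt ?_⟩
      have h := hN m hm n hn
      rw [lt_div_iff₀ (by positivity)] at h
      rw [div_lt_iff₀ (by positivity)]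
      nlinarith [dist_nonneg (x := u m) (y := u n)]
    have hlim' : ∀ w ∈ ball z (R / 4), ∃ l, Tendsto (fun n => fderiv ℂ (F n) w) atTop (𝓝 l) :=
      fun w hw => cauchySeq_tendsto_of_complete (hunif.cauchySeq hw)
    choose! G' hG' using hlim'
    have hsub : ball z (R / 4) ⊆ (U : Set (ℂ × ℂ)) := hin z (mem_ball_self (by positivity)) z
      (mem_ball_self (by positivity))
    refine (hasFDerivAt_of_tendstoUniformlyOn isOpen_ball
      (hunif.tendstoUniformlyOn_of_tendsto hG') (fun n x hx => ?_) (fun x hx => hG x (hsub hx))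
      (mem_ball_self (by positivity))).differentiableAt.differentiableWithinAt
    exact ((hF n).differentiableAt (U.isOpen.mem_nhds (hsub hx))).hasFDerivAt
  · obtain ⟨ns, hns⟩ := (tendstoInMeasure_of_tendsto_Lp hlim).exists_seq_tendsto_ae'
    filter_upwards [hns.2, ae_all_iff.2 huF, ae_restrict_mem U.isOpen.measurableSet]
      with x hx hxF hxU
    refine tendsto_nhds_unique hx ?_
    simp_rw [hxF]
    exact (hG x hxU).comp hns.1

instance completeSpace_bergmanSpace (U : TopologicalSpace.Opens (ℂ × ℂ)) :
    CompleteSpace (bergmanSpace 2 U) :=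
  (isClosed_bergmanSpace U).completeSpace_coe

/-! ### The Bergman projection and the weighted spaces -/

/-- The Bergman projection `B_U : L²(U) → A²(U)`, the orthogonal projection. -/
noncomputable def bergmanProjection (U : TopologicalSpace.Opens (ℂ × ℂ)) :
    Lp ℂ 2 (volume.restrict (U : Set (ℂ × ℂ))) →L[ℂ] bergmanSpace 2 U :=
  (bergmanSpace 2 U).orthogonalProjectionOnto

/-- The measure `ω dV` on `U`. -/
noncomputable def weightedVolume (U : TopologicalSpace.Opens (ℂ × ℂ)) (ω : ℂ × ℂ → ℝ) :
    Measure (ℂ × ℂ) :=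
  (volume.restrict (U : Set (ℂ × ℂ))).withDensity fun w => ENNReal.ofReal (ω w)

/-- The weighted space `L^p(U, ω)`, with `‖f‖^p = ∫_U |f|^p ω dV`. -/
noncomputable abbrev weightedLp (p : ℝ≥0∞) (U : TopologicalSpace.Opens (ℂ × ℂ))
    (ω : ℂ × ℂ → ℝ) : AddSubgroup ((ℂ × ℂ) →ₘ[weightedVolume U ω] ℂ) :=
  Lp ℂ p (weightedVolume U ω)

/-- The bidisc `𝔻²`. -/
def bidisc : TopologicalSpace.Opens (ℂ × ℂ) where
  carrier := {w | ‖w.1‖ < 1 ∧ ‖w.2‖ < 1}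
  is_open' := by
    refine IsOpen.and ?_ ?_ <;> exact isOpen_lt (by fun_prop) (by fun_prop)

/-- The product `𝔻* × 𝔻` of the punctured disc and the disc. -/
def puncturedBidisc : TopologicalSpace.Opens (ℂ × ℂ) where
  carrier := {w | 0 < ‖w.1‖ ∧ ‖w.1‖ < 1 ∧ ‖w.2‖ < 1}
  is_open' := by
    refine IsOpen.and ?_ (IsOpen.and ?_ ?_) <;> exact isOpen_lt (by fun_prop) (by fun_prop)

/-- `F` is the sum on `𝔻²` of the Taylor series `∑ a μ ν * w₁ ^ μ * w₂ ^ ν`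
(in particular `F` is holomorphic there and the coefficients `a` are determined by `F`). -/
def HasTaylorExpansion (F : ℂ × ℂ → ℂ) (a : ℕ → ℕ → ℂ) : Prop :=
  ∀ w ∈ bidisc, HasSum (fun n : ℕ × ℕ => a n.1 n.2 * w.1 ^ n.1 * w.2 ^ n.2) (F w)

/-- The spaces `L^p` with `2 ≤ p < ∞` are normed spaces. -/
instance fact_one_le_ofReal {p : ℝ} [hp : Fact (2 ≤ p)] : Fact (1 ≤ ENNReal.ofReal p) :=
  ⟨by rw [ENNReal.one_le_ofReal]; linarith [hp.out]⟩

open ComplexConjugate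

/-! The line `w₁ = 0` is Lebesgue null, so integration over `𝔻* × 𝔻` is integration over `𝔻²`. The
kernel is therefore that of the bidisc, `π⁻² K(z₁ w̄₁) K(z₂ w̄₂)` with `K(u) = (1 - u)⁻² = ∑ (n + 1)
uⁿ`. It reproduces every `g ∈ A²(𝔻* × 𝔻)` (`sesquiIntegral_eq_self`): the slices in `w₂` live on the
full disc, and those in `w₁` are square-integrable, so their singularity at `0` is removable. As the
conjugated kernel lies in `A²`, orthogonality identifies the Bergman projection with the integral
operator (`bergmanProjection_ae_eq`). Integrals against `K(z w̄)` also define holomorphic functions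
on all of `𝔻²`, so reproduction extends a member of `A^p(𝔻* × 𝔻)` to `𝔻²`.

Boundedness on `L^p` is the Schur test for `|K(z₁ w̄₁) K(z₂ w̄₂)|` with products of powers of `1 -
|wⱼ|` as test functions; the Forelli–Rudin estimate supplies its hypotheses. Since `p ≥ 2`, the
weight `|w₁|^(2-p)` is at least `1`, so the weighted space embeds contractively in `L^p`, and then
in `L²` because the measure is finite.

The multiplier `1 + 1/(μ+1) = (μ+2)/(μ+1)` turns `∑ (n+1) uⁿ` into `∑ (n+2) uⁿ = (1 - u)⁻² + (1 -
u)⁻¹`. Thus `T` is the integral operator with this function replacing `K` in the first variable, and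
since it is at most `3|K|` the same Schur test bounds it. Multiplication by `|w₁|²` maps `L^p` into
the weighted space because `|w₁|^(2p) |w₁|^(2-p) ≤ 1`. Finally, the disc projection sends `|w|² w^μ`
to `(μ+1)/(μ+2) w^μ`, which `T` compensates. This is proved for whole functions: Cauchy's formula on
circles leaves a radial integral with an explicit primitive. Surjectivity follows from the right
inverse. -/

/-! ### Polar coordinates on the unit disc -/

theorem Complex.polarCoord_symm_eq_circleMap (p : ℝ × ℝ) :
    Complex.polarCoord.symm p = circleMap 0 p.1 p.2 := by
  simp [Complex.polarCoord_symm_apply, circleMap, Complex.exp_mul_I]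

theorem Complex.integrableOn_polarCoord_symm {f : ℂ → ℂ} (hf : Integrable f) :
    IntegrableOn (fun p : ℝ × ℝ => p.1 • f (Complex.polarCoord.symm p)) polarCoord.target := by
  have h1 : Integrable (fun p : ℝ × ℝ => f (Complex.measurableEquivRealProd.symm p)) :=
    ((Complex.volume_preserving_equiv_real_prod.symm).integrable_comp_emb
      Complex.measurableEquivRealProd.symm.measurableEmbedding).2 hf
  have h2 := (integrableOn_image_iff_integrableOn_abs_det_fderiv_smul volume
    (measurableSet_Ioi.prod measurableSet_Ioo)
    (fun p _ => (hasFDerivAt_polarCoord_symm p).hasFDerivWithinAt) polarCoord.symm.injOn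
    (fun p : ℝ × ℝ => f (Complex.measurableEquivRealProd.symm p))).1 h1.integrableOn
  refine h2.congr_fun (fun p hp => ?_) polarCoord.open_target.measurableSet
  simp only [det_fderivPolarCoordSymm, abs_of_pos (show 0 < p.1 from hp.1),
    Complex.measurableEquivRealProd_symm_polarCoord_symm_apply]

theorem circleMap_mem_unitBall_iff {r θ : ℝ} (hr : 0 < r) :
    circleMap 0 r θ ∈ ball (0 : ℂ) 1 ↔ r < 1 := by
  simp [abs_of_pos hr]

theorem integral_unitDisc_polar {f : ℂ → ℂ} (hf : IntegrableOn f (ball 0 1)) :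
    ∫ w in ball (0 : ℂ) 1, f w =
      ∫ r in Set.Ioo (0 : ℝ) 1, (r : ℂ) * ∫ θ in Set.Ioo (-Real.pi) Real.pi,
        f (circleMap 0 r θ) := by
  have hi := (integrable_indicator_iff measurableSet_ball).2 hf
  have h1 := Complex.integrableOn_polarCoord_symm hi
  rw [← integral_indicator measurableSet_ball, ← Complex.integral_comp_polarCoord_symm]
  rw [polarCoord_target, Measure.volume_eq_prod] at h1 ⊢
  rw [setIntegral_prod _ h1]
  have : Set.Ioo (0 : ℝ) 1 = Set.Ioi 0 ∩ Set.Iio 1 := rfl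
  rw [this, ← setIntegral_indicator measurableSet_Iio]
  refine setIntegral_congr_fun measurableSet_Ioi fun r hr => ?_
  have hr : 0 < r := hr
  simp only [Complex.polarCoord_symm_eq_circleMap]
  rw [integral_smul, Complex.real_smul]
  by_cases h : r < 1
  · rw [Set.indicator_of_mem (show r ∈ Set.Iio 1 from h)]
    congr 1
    refine integral_congr_ae (Eventually.of_forall fun θ => ?_)
    exact Set.indicator_of_mem ((circleMap_mem_unitBall_iff hr).2 h) _
  · rw [Set.indicator_of_notMem (show r ∉ Set.Iio 1 from h)]
    have : ∀ θ, (ball (0 : ℂ) 1).indicator f (circleMap 0 r θ) = 0 := fun θ =>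
      Set.indicator_of_notMem (by rwa [circleMap_mem_unitBall_iff hr]) _
    simp [this]

theorem lintegral_unitDisc_polar {f : ℂ → ℝ≥0∞} (hf : Measurable f) :
    ∫⁻ w in ball (0 : ℂ) 1, f w =
      ∫⁻ r in Set.Ioo (0 : ℝ) 1, ENNReal.ofReal r * ∫⁻ θ in Set.Ioo (-Real.pi) Real.pi,
        f (circleMap 0 r θ) := by
  rw [← lintegral_indicator measurableSet_ball, ← Complex.lintegral_comp_polarCoord_symm,
    polarCoord_target, Measure.volume_eq_prod, ← Measure.prod_restrict, lintegral_prod]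
  · have : Set.Ioo (0 : ℝ) 1 = Set.Ioi 0 ∩ Set.Iio 1 := rfl
    rw [this, Set.inter_comm, ← setLIntegral_indicator measurableSet_Iio]
    refine setLIntegral_congr_fun measurableSet_Ioi fun r hr => ?_
    have hr : 0 < r := hr
    simp only [Complex.polarCoord_symm_eq_circleMap, smul_eq_mul]
    by_cases h : r < 1
    · rw [Set.indicator_of_mem (show r ∈ Set.Iio 1 from h),
        lintegral_const_mul' _ _ ENNReal.ofReal_ne_top]
      congr 1
      refine lintegral_congr fun θ => ?_
      exact Set.indicator_of_mem ((circleMap_mem_unitBall_iff hr).2 h) _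
    · rw [Set.indicator_of_notMem (show r ∉ Set.Iio 1 from h)]
      have : ∀ θ, (ball (0 : ℂ) 1).indicator f (circleMap 0 r θ) = 0 := fun θ =>
        Set.indicator_of_notMem (by rwa [circleMap_mem_unitBall_iff hr]) _
      simp [this]
  · refine Measurable.aemeasurable ?_
    refine (ENNReal.measurable_ofReal.comp measurable_fst).smul
      ((hf.indicator measurableSet_ball).comp ?_)
    change Measurable fun p : ℝ × ℝ => Complex.polarCoord.symm p
    simp_rw [Complex.polarCoord_symm_apply]
    fun_prop

theorem setIntegral_circleMap_eq {f : ℂ → ℂ} (r : ℝ) :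
    ∫ θ in Set.Ioo (-Real.pi) Real.pi, f (circleMap 0 r θ) =
      ∫ θ in (0)..(2 * Real.pi), f (circleMap 0 r θ) := by
  have hper : Function.Periodic (fun θ => f (circleMap 0 r θ)) (2 * Real.pi) := fun θ => by
    simp [periodic_circleMap 0 r θ]
  have h2 := hper.intervalIntegral_add_eq 0 (-Real.pi)
  rw [zero_add, show -Real.pi + 2 * Real.pi = Real.pi by ring] at h2
  rw [h2, intervalIntegral.integral_of_le (by linarith [Real.pi_pos]),
    integral_Ioc_eq_integral_Ioo]

theorem circleMap_mul_conj (r θ : ℝ) :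
    circleMap 0 r θ * conj (circleMap 0 r θ) = (r : ℂ) ^ 2 := by
  rw [Complex.mul_conj, Complex.normSq_eq_norm_sq]
  simp

/-! ### Integrals against the Bergman kernel of the disc -/

theorem one_sub_mul_conj_ne_zero {z w : ℂ} (hz : ‖z‖ < 1) (hw : ‖w‖ < 1) :
    1 - z * conj w ≠ 0 := by
  intro h
  have h1 : ‖z * conj w‖ = 1 := by rw [← sub_eq_zero.1 h]; simp
  rw [norm_mul, RCLike.norm_conj] at h1
  nlinarith [norm_nonneg z, norm_nonneg w]

/-- On `|w| = r` one has `w̄ = r²/w`, so `(1 - z w̄)⁻² = w² (w - z r²)⁻²`. With `dw = i w dθ` the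
integral becomes Cauchy's formula for the derivative of `w g(w)` at `z r²`. -/
theorem circle_bergman_kernel {g : ℂ → ℂ} (hg : DifferentiableOn ℂ g (ball 0 1)) {z : ℂ}
    (hz : ‖z‖ < 1) {r : ℝ} (h0 : 0 < r) (h1 : r < 1) :
    ∫ θ in Set.Ioo (-Real.pi) Real.pi,
      g (circleMap 0 r θ) * ((1 - z * conj (circleMap 0 r θ)) ^ 2)⁻¹ =
      2 * Real.pi * deriv (fun w => w * g w) (z * r ^ 2) := by
  have hc : closedBall (0 : ℂ) r ⊆ ball 0 1 := closedBall_subset_ball h1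
  have hz0 : z * r ^ 2 ∈ ball (0 : ℂ) r := by
    simp only [mem_ball_zero_iff, norm_mul, norm_pow, Complex.norm_real, Real.norm_eq_abs,
      abs_of_pos h0]
    nlinarith [norm_nonneg z]
  have h := Complex.two_pi_I_inv_smul_circleIntegral_sub_sq_inv_smul_of_differentiable isOpen_ball
    hc (f := fun w => w * g w) (by fun_prop) hz0
  rw [setIntegral_circleMap_eq (f := fun w => g w * ((1 - z * conj w) ^ 2)⁻¹)]
  rw [← h, circleIntegral]
  have hI : (Real.pi : ℂ) ≠ 0 := by exact_mod_cast Real.pi_ne_zero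
  have : ∀ θ : ℝ, deriv (circleMap 0 r) θ • ((circleMap 0 r θ - z * r ^ 2) ^ 2)⁻¹ •
      (circleMap 0 r θ * g (circleMap 0 r θ)) =
      Complex.I * (g (circleMap 0 r θ) * ((1 - z * conj (circleMap 0 r θ)) ^ 2)⁻¹) := by
    intro θ
    have hw : circleMap 0 r θ ≠ 0 := circleMap_ne_center h0.ne'
    have hk := one_sub_mul_conj_ne_zero (w := circleMap 0 r θ) hz (by simpa [abs_of_pos h0])
    rw [← circleMap_mul_conj r θ]
    simp only [deriv_circleMap, smul_eq_mul]
    set w := circleMap 0 r θ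
    have : w - z * (w * conj w) = w * (1 - z * conj w) := by ring
    rw [this]
    field_simp
  simp_rw [this]
  rw [intervalIntegral.integral_const_mul]
  simp only [smul_eq_mul]
  field_simp

/-- Integration of a holomorphic function with a radial weight against the Bergman kernel of the
disc. -/
theorem disc_bergman_kernel {g : ℂ → ℂ} (hg : DifferentiableOn ℂ g (ball 0 1)) {z : ℂ}
    (hz : ‖z‖ < 1) (φ : ℝ → ℂ)
    (hi : IntegrableOn (fun w => φ ‖w‖ * g w * ((1 - z * conj w) ^ 2)⁻¹) (ball 0 1)) :
    ∫ w in ball (0 : ℂ) 1, φ ‖w‖ * g w * ((1 - z * conj w) ^ 2)⁻¹ =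
      Real.pi * ∫ r in (0 : ℝ)..1, 2 * r * φ r * deriv (fun w => w * g w) (z * r ^ 2) := by
  rw [integral_unitDisc_polar hi, intervalIntegral.integral_of_le zero_le_one,
    integral_Ioc_eq_integral_Ioo, ← integral_const_mul]
  refine setIntegral_congr_fun measurableSet_Ioo fun r hr => ?_
  have : ∀ θ, ‖circleMap 0 r θ‖ = r := fun θ => by simp [abs_of_pos hr.1]
  simp only [this, mul_assoc]
  rw [integral_const_mul, circle_bergman_kernel hg hz hr.1 hr.2]
  ring

theorem mul_sq_mem_unitBall {z : ℂ} (hz : ‖z‖ < 1) {r : ℝ} (hr : r ∈ Set.uIcc 0 1) :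
    z * (r : ℂ) ^ 2 ∈ ball (0 : ℂ) 1 := by
  rw [Set.uIcc_of_le zero_le_one] at hr
  simp only [mem_ball_zero_iff, norm_mul, norm_pow, Complex.norm_real, Real.norm_eq_abs,
      abs_of_nonneg hr.1]
  nlinarith [norm_nonneg z, pow_le_one₀ (n := 2) hr.1 hr.2, hr.1]

theorem hasDerivAt_comp_mul_sq {g : ℂ → ℂ} (hg : DifferentiableOn ℂ g (ball 0 1)) {z : ℂ}
    (hz : ‖z‖ < 1) {r : ℝ} (hr : r ∈ Set.uIcc 0 1) :
    HasDerivAt (fun s : ℝ => g (z * (s : ℂ) ^ 2)) (deriv g (z * r ^ 2) * (2 * z * r)) r := by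
  have h1 := ((hg _ (mul_sq_mem_unitBall hz hr)).differentiableAt
    (isOpen_ball.mem_nhds (mul_sq_mem_unitBall hz hr))).hasDerivAt
  have h2 : HasDerivAt (fun s : ℝ => z * (s : ℂ) ^ 2) (2 * z * r) r := by
    have := (((hasDerivAt_id (r : ℂ)).pow 2).const_mul z).comp_ofReal
    refine this.congr_deriv ?_
    simp; ring
  exact h1.comp r h2

theorem continuousOn_deriv_comp_mul_sq {g : ℂ → ℂ} (hg : DifferentiableOn ℂ g (ball 0 1)) {z : ℂ}
    (hz : ‖z‖ < 1) : ContinuousOn (fun r : ℝ => deriv g (z * (r : ℂ) ^ 2)) (Set.uIcc 0 1) :=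
  (hg.deriv isOpen_ball).continuousOn.comp (by fun_prop) fun _ hr => mul_sq_mem_unitBall hz hr

/-- The reproducing property of the Bergman kernel of the disc. -/
theorem disc_bergman_reproducing {g : ℂ → ℂ} (hg : DifferentiableOn ℂ g (ball 0 1)) {z : ℂ}
    (hz : ‖z‖ < 1) (hi : IntegrableOn (fun w => g w * ((1 - z * conj w) ^ 2)⁻¹) (ball 0 1)) :
    ∫ w in ball (0 : ℂ) 1, g w * ((1 - z * conj w) ^ 2)⁻¹ = Real.pi * g z := by
  have h := disc_bergman_kernel hg hz (fun _ => 1) (by simpa using hi)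
  simp only [one_mul, mul_one] at h
  have hwg : DifferentiableOn ℂ (fun w => w * g w) (ball 0 1) := differentiableOn_id.mul hg
  rw [h]
  congr 1
  -- The radial integrand `2r (w g)'(z r²)` is the derivative of `r² g(z r²)`.
  have hFTC := intervalIntegral.integral_eq_sub_of_hasDerivAt (a := 0) (b := 1)
    (f := fun r : ℝ => (r : ℂ) ^ 2 * g (z * (r : ℂ) ^ 2))
    (f' := fun r : ℝ => 2 * r * deriv (fun w => w * g w) (z * r ^ 2)) (fun r hr => ?_)
    (ContinuousOn.intervalIntegrable
      ((by fun_prop : ContinuousOn (fun r : ℝ => 2 * (r : ℂ)) _).mul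
        (continuousOn_deriv_comp_mul_sq hwg hz)))
  · simpa using hFTC
  · have h1 : HasDerivAt (fun s : ℝ => (s : ℂ) ^ 2) (2 * r) r := by
      simpa using ((hasDerivAt_id (r : ℂ)).pow 2).comp_ofReal
    refine (h1.mul (hasDerivAt_comp_mul_sq hg hz hr)).congr_deriv ?_
    have hd := (hg _ (mul_sq_mem_unitBall hz hr)).differentiableAt
      (isOpen_ball.mem_nhds (mul_sq_mem_unitBall hz hr))
    have := ((hasDerivAt_id (z * (r : ℂ) ^ 2)).mul hd.hasDerivAt).deriv
    change deriv (fun w => w * g w) _ = _ at this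
    rw [this]
    simp only [id]
    ring

/-- The relation `(w² g)' = w (w G)'` makes `(w² g)(z r²) / z²` a primitive in `r` of the radial
integrand `2r · r² (w G)'(z r²)`. Dividing by `z²` is why `z ≠ 0` is required. -/
theorem disc_bergman_weighted {g G : ℂ → ℂ} (hg : DifferentiableOn ℂ g (ball 0 1))
    (hG : DifferentiableOn ℂ G (ball 0 1))
    (hgG : ∀ w ∈ ball (0 : ℂ) 1,
      deriv (fun u => u ^ 2 * g u) w = w * deriv (fun u => u * G u) w) {z : ℂ}
    (hz : ‖z‖ < 1) (hz0 : z ≠ 0)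
    (hi : IntegrableOn (fun w => (‖w‖ : ℂ) ^ 2 * G w * ((1 - z * conj w) ^ 2)⁻¹) (ball 0 1)) :
    ∫ w in ball (0 : ℂ) 1, (‖w‖ : ℂ) ^ 2 * G w * ((1 - z * conj w) ^ 2)⁻¹ = Real.pi * g z := by
  rw [disc_bergman_kernel hG hz (fun r => (r : ℂ) ^ 2) hi]
  have hwg : DifferentiableOn ℂ (fun w => w ^ 2 * g w) (ball 0 1) := by fun_prop
  have hwG : DifferentiableOn ℂ (fun w => w * G w) (ball 0 1) := by fun_prop
  congr 1
  have hFTC := intervalIntegral.integral_eq_sub_of_hasDerivAt (a := 0) (b := 1)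
    (f := fun r : ℝ => (fun w => w ^ 2 * g w) (z * (r : ℂ) ^ 2) / z ^ 2)
    (f' := fun r : ℝ => 2 * r * (r : ℂ) ^ 2 * deriv (fun w => w * G w) (z * r ^ 2)) (fun r hr => ?_)
    (ContinuousOn.intervalIntegrable
      ((by fun_prop : ContinuousOn (fun r : ℝ => 2 * (r : ℂ) * (r : ℂ) ^ 2) _).mul
        (continuousOn_deriv_comp_mul_sq hwG hz)))
  · rw [hFTC]
    simp
    field_simp
  · refine ((hasDerivAt_comp_mul_sq hwg hz hr).div_const (z ^ 2)).congr_deriv ?_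
    rw [hgG _ (mul_sq_mem_unitBall hz hr)]
    field_simp

/-! ### Power series form of the multiplier relation -/

/-- Absolute convergence at a radius `ρ` with `|w| < ρ < 1` dominates the series on the disc of
radius `ρ`, so it may be differentiated termwise. -/
theorem hasSum_deriv_pow_mul {h : ℂ → ℂ} {c : ℕ → ℂ}
    (hh : ∀ w ∈ ball (0 : ℂ) 1, HasSum (fun n => c n * w ^ n) (h w)) (k : ℕ) {w : ℂ}
    (hw : w ∈ ball (0 : ℂ) 1) :
    HasSum (fun n => c n * ((n + k : ℕ) * w ^ (n + k - 1))) (deriv (fun u => u ^ k * h u) w) := by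
  obtain ⟨ρ, hρ, hρ1⟩ := exists_between (mem_ball_zero_iff.1 hw)
  have hρ0 : 0 < ρ := (norm_nonneg _).trans_lt hρ
  have hs : Summable fun n => ‖c n‖ * ρ ^ (n + k) := by
    have := ((hh ρ (by simpa [abs_of_pos hρ0])).summable.norm).mul_right (ρ ^ k)
    refine this.congr fun n => ?_
    simp [abs_of_pos hρ0, pow_add, mul_assoc]
  have h1 := Complex.hasSum_deriv_of_summable_norm (F := fun n u => c n * u ^ (n + k)) hs
    (fun n => by fun_prop) isOpen_ball (fun n u hu => by
      rw [norm_mul, norm_pow]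
      have := (mem_ball_zero_iff.1 hu).le
      gcongr) (mem_ball_zero_iff.2 hρ)
  have h2 : (fun u => ∑' n, c n * u ^ (n + k)) =ᶠ[𝓝 w] fun u => u ^ k * h u := by
    filter_upwards [isOpen_ball.mem_nhds hw] with u hu
    have := ((hh u hu).mul_left (u ^ k)).tsum_eq
    rw [← this]
    exact tsum_congr fun n => by ring
  rw [h2.deriv_eq] at h1
  have h3 : ∀ n, deriv (fun u => c n * u ^ (n + k)) w = c n * ((n + k : ℕ) * w ^ (n + k - 1)) := by
    intro n
    rw [deriv_const_mul_field, deriv_pow_field]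
  simpa only [h3] using h1

/-- Both sides have the coefficient `(n + 2) b n` at `w ^ (n + 1)`. -/
theorem deriv_sq_mul_eq_of_hasSum {g G : ℂ → ℂ} {b : ℕ → ℂ}
    (hg : ∀ w ∈ ball (0 : ℂ) 1, HasSum (fun n => b n * w ^ n) (g w))
    (hG : ∀ w ∈ ball (0 : ℂ) 1, HasSum (fun n : ℕ => (1 + 1 / ((n : ℂ) + 1)) * b n * w ^ n) (G w))
    {w : ℂ} (hw : w ∈ ball (0 : ℂ) 1) :
    deriv (fun u => u ^ 2 * g u) w = w * deriv (fun u => u * G u) w := by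
  have h1 := hasSum_deriv_pow_mul hg 2 hw
  have h2 := (hasSum_deriv_pow_mul hG 1 hw).mul_left w
  simp only [pow_one] at h2
  have h3 : ∀ n : ℕ, b n * ((n + 2 : ℕ) * w ^ (n + 2 - 1)) =
      w * ((1 + 1 / ((n : ℂ) + 1)) * b n * ((n + 1 : ℕ) * w ^ (n + 1 - 1))) := by
    intro n
    have : (n : ℂ) + 1 ≠ 0 := by exact_mod_cast n.succ_ne_zero
    simp only [Nat.add_sub_cancel, show n + 2 - 1 = n + 1 from rfl]
    push_cast
    field_simp
    ring
  simp only [h3] at h1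
  exact h1.unique h2

/-! ### Removable singularities of square-integrable functions -/

/-- The sub-mean value property of `f²` on the disc of centre `w` and radius `|w|`, which avoids
`0`, gives `π |w f(w)|² ≤ ∫ |f|²` over the disc of radius `2|w|` about `0`. This tends to `0` with
`w`, so `f = o(1/|w|)` and Riemann's theorem applies. -/
theorem exists_extension_of_sq_integrable {f : ℂ → ℂ}
    (hf : DifferentiableOn ℂ f (ball 0 1 \ {0}))
    (h2 : ∫⁻ w in ball (0 : ℂ) 1, ‖f w‖ₑ ^ 2 ≠ ⊤) :
    ∃ F : ℂ → ℂ, DifferentiableOn ℂ F (ball 0 1) ∧ ∀ w ≠ 0, F w = f w := by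
  refine ⟨_, Complex.differentiableOn_update_limUnder_of_isLittleO (ball_mem_nhds 0 one_pos) hf ?_,
    fun w hw => Function.update_of_ne hw _ _⟩
  simp only [sub_zero]
  -- The criterion concerns `f w - f 0`; the arbitrary value `f 0` is a constant, hence `o(1/|w|)`.
  refine Asymptotics.IsLittleO.sub ?_ ((Asymptotics.isLittleO_const_left).2
    (Or.inr tendsto_norm_inv_nhdsNE_zero_atTop))
  have hmeas : Tendsto ((volume.restrict (ball (0 : ℂ) 1)) ∘ fun w : ℂ => ball (0 : ℂ) (2 * ‖w‖))
      (𝓝[≠] 0) (𝓝 0) := by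
    have h0 : Tendsto (fun w : ℂ => ENNReal.ofReal (2 * ‖w‖) ^ 2 * NNReal.pi) (𝓝[≠] 0) (𝓝 0) := by
      have : Tendsto (fun w : ℂ => ENNReal.ofReal (2 * ‖w‖)) (𝓝 0) (𝓝 0) := by
        have h : Continuous fun w : ℂ => ENNReal.ofReal (2 * ‖w‖) :=
          ENNReal.continuous_ofReal.comp (by fun_prop)
        simpa using h.tendsto 0
      have h3 := ENNReal.Tendsto.mul_const (b := (NNReal.pi : ℝ≥0∞))
        (ENNReal.Tendsto.pow (n := 2) (this.mono_left (nhdsWithin_le_nhds (s := {0}ᶜ))))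
        (Or.inr ENNReal.coe_ne_top)
      simp only [ne_eq, OfNat.ofNat_ne_zero, not_false_eq_true, zero_pow, zero_mul] at h3
      exact h3
    refine tendsto_of_tendsto_of_tendsto_of_le_of_le tendsto_const_nhds h0
      (fun _ => zero_le) fun w => ?_
    exact (Measure.restrict_apply_le _ _).trans (Complex.volume_ball _ _).le
  have hlim := tendsto_setLIntegral_zero h2 hmeas
  have hsq : Tendsto (fun w => ‖f w * w‖ₑ ^ 2 * NNReal.pi) (𝓝[≠] 0) (𝓝 0) := by
    refine tendsto_of_tendsto_of_tendsto_of_le_of_le' tendsto_const_nhds hlim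
      (Eventually.of_forall fun _ => zero_le) ?_
    have hev : ∀ᶠ w : ℂ in 𝓝[≠] 0, w ∈ ball (0 : ℂ) (1 / 2) :=
      nhdsWithin_le_nhds (ball_mem_nhds 0 (by norm_num))
    filter_upwards [hev, self_mem_nhdsWithin] with w hw hw0
    rw [mem_ball_zero_iff] at hw
    have hsub : ball w ‖w‖ ⊆ ball 0 1 \ {0} := by
      intro u hu
      rw [mem_ball, dist_eq_norm] at hu
      refine ⟨?_, ?_⟩
      · rw [mem_ball_zero_iff]
        linarith [norm_le_norm_add_norm_sub' u w]
      · rintro rfl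
        simp at hu
    have hb := disc_enorm_bound (f := fun u => f u ^ 2) ((hf.mono hsub).pow 2)
    simp only [enorm_pow] at hb
    rw [Complex.volume_ball, ← mul_assoc, ← mul_pow, ofReal_norm, ← enorm_mul] at hb
    refine hb.trans ?_
    rw [Measure.restrict_restrict measurableSet_ball]
    refine lintegral_mono_set fun u hu => ⟨?_, (hsub hu).1⟩
    rw [mem_ball, dist_eq_norm] at hu
    rw [mem_ball_zero_iff]
    linarith [norm_le_norm_add_norm_sub' u w]
  have hsq' : Tendsto (fun w => ‖f w * w‖ₑ) (𝓝[≠] 0) (𝓝 0) := by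
    have hpi : (NNReal.pi : ℝ≥0∞) ≠ 0 := by simpa using NNReal.pi_ne_zero
    have h1 := ENNReal.Tendsto.div_const hsq (Or.inr hpi)
    have h3 := ((ENNReal.continuous_rpow_const (y := 1 / 2)).tendsto _).comp h1
    rw [ENNReal.zero_div, ENNReal.zero_rpow_of_pos (by norm_num)] at h3
    refine h3.congr fun w => ?_
    simp only [Function.comp]
    rw [ENNReal.mul_div_cancel_right hpi ENNReal.coe_ne_top, ← ENNReal.rpow_natCast,
      ← ENNReal.rpow_mul]
    norm_num
  rw [Asymptotics.isLittleO_iff_tendsto' (by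
    filter_upwards [self_mem_nhdsWithin] with w hw h
    exact absurd h (inv_ne_zero hw))]
  simp only [div_inv_eq_mul]
  rw [tendsto_zero_iff_norm_tendsto_zero]
  have h4 := (ENNReal.tendsto_toReal ENNReal.zero_ne_top).comp hsq'
  simpa [Function.comp_def] using h4

/-! ### The Forelli–Rudin estimate and the Schur test -/

/-- For `|w| = r` one has `|w - z r²| = r |1 - z w̄|`, so `(1 - |z|² r²) |1 - z w̄|⁻²` is the
Poisson kernel of the circle at `z r²`, whose mean is `1`. -/
theorem poisson_circle_lintegral {z : ℂ} (hz : ‖z‖ < 1) {r : ℝ} (h0 : 0 < r) (h1 : r < 1) :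
    ∫⁻ θ in Set.Ioo (-Real.pi) Real.pi, ‖((1 - z * conj (circleMap 0 r θ)) ^ 2)⁻¹‖ₑ =
      ENNReal.ofReal (2 * Real.pi / (1 - ‖z‖ ^ 2 * r ^ 2)) := by
  have hw : z * r ^ 2 ∈ ball (0 : ℂ) r := by
    simp only [mem_ball_zero_iff, norm_mul, norm_pow, Complex.norm_real, Real.norm_eq_abs,
      abs_of_pos h0]
    nlinarith [norm_nonneg z]
  have hcirc : ∀ θ, ‖circleMap 0 r θ‖ = r := fun θ => by simp [abs_of_pos h0]
  have hk : ∀ θ, 1 - z * conj (circleMap 0 r θ) ≠ 0 := fun θ =>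
    one_sub_mul_conj_ne_zero hz (by rwa [hcirc])
  have hcont : Continuous fun θ => ‖((1 - z * conj (circleMap 0 r θ)) ^ 2)⁻¹‖ := by
    refine (Continuous.inv₀ ?_ fun θ => pow_ne_zero 2 (hk θ)).norm
    have := continuous_circleMap 0 r
    fun_prop
  have hint : IntegrableOn (fun θ => ‖((1 - z * conj (circleMap 0 r θ)) ^ 2)⁻¹‖)
      (Set.Ioo (-Real.pi) Real.pi) :=
    (hcont.integrableOn_Icc).mono_set Set.Ioo_subset_Icc_self
  simp_rw [← ofReal_norm]
  rw [← ofReal_integral_eq_lintegral_ofReal hint (ae_of_all _ fun _ => norm_nonneg _)]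
  congr 1
  have hP := DiffContOnCl.circleAverage_poissonKernel_smul' (c := 0) (R := r) (f := fun _ => (1 : ℂ))
    diffContOnCl_const hw
  rw [Real.circleAverage, ← setIntegral_circleMap_eq (f := fun w =>
    ((‖w - 0‖ ^ 2 - ‖z * r ^ 2 - 0‖ ^ 2) / ‖w - 0 - (z * r ^ 2 - 0)‖ ^ 2) • (1 : ℂ))] at hP
  simp only [sub_zero, hcirc, Complex.real_smul, mul_one] at hP
  rw [integral_complex_ofReal] at hP
  rw [← Complex.ofReal_mul, Complex.ofReal_eq_one] at hP
  have hden : 0 < 1 - ‖z‖ ^ 2 * r ^ 2 := by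
    have : ‖z‖ * r < 1 := by nlinarith [norm_nonneg z]
    nlinarith [mul_nonneg (norm_nonneg z) h0.le]
  have hpt : ∀ θ, (r ^ 2 - ‖z * r ^ 2‖ ^ 2) / ‖circleMap 0 r θ - z * r ^ 2‖ ^ 2 =
      (1 - ‖z‖ ^ 2 * r ^ 2) * ‖((1 - z * conj (circleMap 0 r θ)) ^ 2)⁻¹‖ := by
    intro θ
    have h2 : circleMap 0 r θ - z * r ^ 2 =
        circleMap 0 r θ * (1 - z * conj (circleMap 0 r θ)) := by
      rw [← circleMap_mul_conj r θ]; ring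
    have hn := norm_pos_iff.2 (hk θ)
    rw [h2, norm_mul (circleMap 0 r θ), hcirc, norm_inv, norm_pow, norm_mul, norm_pow, Complex.norm_real,
      Real.norm_eq_abs, abs_of_pos h0]
    field_simp
  simp_rw [hpt] at hP
  rw [integral_const_mul] at hP
  have hpi := Real.pi_pos
  field_simp at hP ⊢
  linarith

/-- Split at `u = d`: the inner part is `d^(-a)/(1-a)`, finite as `a < 1`, and the outer part is
`d^(-a)/a`, finite as `a > 0`. -/
theorem lintegral_rpow_div_max {a : ℝ} (h0 : 0 < a) (h1 : a < 1) {d : ℝ} (hd : 0 < d) :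
    ∫⁻ u in Set.Ioi (0 : ℝ), ENNReal.ofReal (u ^ (-a) / max d u) ≤
      ENNReal.ofReal (1 / (1 - a) + 1 / a) * ENNReal.ofReal (d ^ (-a)) := by
  have hi1 : IntegrableOn (fun u : ℝ => u ^ (-a)) (Set.Ioc 0 d) := by
    rw [← intervalIntegrable_iff_integrableOn_Ioc_of_le hd.le]
    exact intervalIntegral.intervalIntegrable_rpow' (by linarith)
  have hi2 : IntegrableOn (fun u : ℝ => u ^ (-a - 1)) (Set.Ioi d) :=
    integrableOn_Ioi_rpow_of_lt (by linarith) hd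
  rw [← Set.Ioc_union_Ioi_eq_Ioi hd.le]
  refine (lintegral_union_le _ _ _).trans ?_
  have e1 : ∫⁻ u in Set.Ioc 0 d, ENNReal.ofReal (u ^ (-a) / max d u) =
      ENNReal.ofReal (d ^ (-a) / (1 - a)) := by
    have : ∫⁻ u in Set.Ioc 0 d, ENNReal.ofReal (u ^ (-a) / max d u) =
        ∫⁻ u in Set.Ioc 0 d, ENNReal.ofReal (u ^ (-a) / d) :=
      setLIntegral_congr_fun measurableSet_Ioc fun u hu => by simp only [max_eq_left hu.2]
    rw [this, ← ofReal_integral_eq_lintegral_ofReal (hi1.div_const d)]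
    · congr 1
      rw [integral_div, ← intervalIntegral.integral_of_le hd.le, integral_rpow (by left; linarith),
        Real.zero_rpow (by linarith), Real.rpow_add hd, Real.rpow_one]
      field_simp
      ring
    · refine (ae_restrict_iff' measurableSet_Ioc).2 (ae_of_all _ fun u hu => ?_)
      have := hu.1
      simp only [Pi.zero_apply]
      positivity
  have e2 : ∫⁻ u in Set.Ioi d, ENNReal.ofReal (u ^ (-a) / max d u) =
      ENNReal.ofReal (d ^ (-a) / a) := by
    have : ∫⁻ u in Set.Ioi d, ENNReal.ofReal (u ^ (-a) / max d u) =
        ∫⁻ u in Set.Ioi d, ENNReal.ofReal (u ^ (-a - 1)) :=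
      setLIntegral_congr_fun measurableSet_Ioi fun u hu => by
        have hu : d < u := hu
        simp only [max_eq_right hu.le, Real.rpow_sub_one (hd.trans hu).ne']
    rw [this, ← ofReal_integral_eq_lintegral_ofReal hi2]
    · congr 1
      rw [integral_Ioi_rpow_of_lt (by linarith) hd]
      simp only [sub_add_cancel]
      field_simp
    · refine (ae_restrict_iff' measurableSet_Ioi).2 (ae_of_all _ fun u hu => ?_)
      have : 0 < u := hd.trans hu
      simp only [Pi.zero_apply]
      positivity
  have := Real.rpow_pos_of_pos hd (-a)
  have h1a : 0 < 1 - a := by linarith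
  rw [e1, e2, ← ENNReal.ofReal_add (by positivity) (by positivity),
    ← ENNReal.ofReal_mul (by positivity)]
  refine ENNReal.ofReal_le_ofReal (le_of_eq ?_)
  ring

/-- The Forelli–Rudin estimate for the Bergman kernel of the disc. -/
theorem exists_forelli_rudin_bound {a : ℝ} (h0 : 0 < a) (h1 : a < 1) : ∃ C : ℝ≥0, ∀ z : ℂ, ‖z‖ < 1 →
    ∫⁻ w in ball (0 : ℂ) 1, ‖((1 - z * conj w) ^ 2)⁻¹‖ₑ * ENNReal.ofReal (1 - ‖w‖) ^ (-a) ≤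
      C * ENNReal.ofReal (1 - ‖z‖) ^ (-a) := by
  refine ⟨(2 * Real.pi * (1 / (1 - a) + 1 / a)).toNNReal, fun z hz => ?_⟩
  have h1a : 0 < 1 - a := by linarith
  rw [lintegral_unitDisc_polar (by fun_prop)]
  have hd : 0 < 1 - ‖z‖ := by linarith
  have hpi := Real.pi_pos
  have step : ∀ r ∈ Set.Ioo (0 : ℝ) 1, (ENNReal.ofReal r *
      ∫⁻ θ in Set.Ioo (-Real.pi) Real.pi, ‖((1 - z * conj (circleMap 0 r θ)) ^ 2)⁻¹‖ₑ *
        ENNReal.ofReal (1 - ‖circleMap 0 r θ‖) ^ (-a)) ≤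
      ENNReal.ofReal (2 * Real.pi) * ENNReal.ofReal ((1 - r) ^ (-a) / max (1 - ‖z‖) (1 - r)) := by
    intro r hr
    have hr1 : 0 < 1 - r := by linarith [hr.2]
    have hcirc : ∀ θ, ‖circleMap 0 r θ‖ = r := fun θ => by simp [abs_of_pos hr.1]
    simp_rw [hcirc]
    rw [lintegral_mul_const' _ _ (by
      rw [ENNReal.ofReal_rpow_of_pos hr1]; exact ENNReal.ofReal_ne_top),
      poisson_circle_lintegral hz hr.1 hr.2, ENNReal.ofReal_rpow_of_pos hr1]
    have hpos := Real.rpow_pos_of_pos hr1 (-a)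
    have hn := norm_nonneg z
    have hzr : ‖z‖ ^ 2 * r ^ 2 ≤ ‖z‖ * r := by
      have : ‖z‖ * r ≤ 1 := by nlinarith [hr.1, hr.2]
      nlinarith [mul_nonneg hn hr.1.le]
    -- The Poisson denominator dominates both `1 - |z|` and `1 - r`; after `u = 1 - r` the remaining
    -- integral is the one bounded by `lintegral_rpow_div_max` with `d = 1 - |z|`.
    have hmax : max (1 - ‖z‖) (1 - r) ≤ 1 - ‖z‖ ^ 2 * r ^ 2 := by
      refine max_le ?_ ?_ <;> nlinarith [hr.1, hr.2]
    have hm : 0 < max (1 - ‖z‖) (1 - r) := lt_max_of_lt_left hd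
    rw [← ENNReal.ofReal_mul (div_nonneg (by positivity) (hm.le.trans hmax)),
      ← ENNReal.ofReal_mul hr.1.le, ← ENNReal.ofReal_mul (by positivity)]
    refine ENNReal.ofReal_le_ofReal ?_
    calc r * (2 * Real.pi / (1 - ‖z‖ ^ 2 * r ^ 2) * (1 - r) ^ (-a))
        ≤ 1 * (2 * Real.pi / max (1 - ‖z‖) (1 - r) * (1 - r) ^ (-a)) := by
          gcongr
          · exact mul_nonneg (div_nonneg (by positivity) (hm.le.trans hmax)) hpos.le
          · exact hr.2.le
      _ = _ := by ring
  refine (setLIntegral_mono' measurableSet_Ioo step).trans ?_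
  rw [lintegral_const_mul' _ _ ENNReal.ofReal_ne_top]
  have hsub : ∫⁻ r in Set.Ioo (0 : ℝ) 1,
      ENNReal.ofReal ((1 - r) ^ (-a) / max (1 - ‖z‖) (1 - r)) ≤
      ∫⁻ u in Set.Ioi (0 : ℝ), ENNReal.ofReal (u ^ (-a) / max (1 - ‖z‖) u) := by
    rw [← lintegral_indicator measurableSet_Ioo, ← lintegral_indicator measurableSet_Ioi,
      ← lintegral_sub_left_eq_self ((Set.Ioi 0).indicator _) (1 : ℝ)]
    refine lintegral_mono fun r => ?_
    by_cases hr : r ∈ Set.Ioo (0 : ℝ) 1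
    · rw [Set.indicator_of_mem hr, Set.indicator_of_mem (show 1 - r ∈ Set.Ioi (0 : ℝ) by
        simpa using hr.2)]
    · rw [Set.indicator_of_notMem hr]
      exact zero_le
  refine (mul_le_mul_right (hsub.trans (lintegral_rpow_div_max h0 h1 hd)) _).trans (le_of_eq ?_)
  rw [ENNReal.ofReal_rpow_of_pos hd, ← mul_assoc, ← ENNReal.ofReal_mul (by positivity)]
  rfl

/-- The **Schur test** for positive integral operators on `L^p`. -/
theorem lintegral_schur_test {α : Type*} [MeasurableSpace α] {μ : Measure α} [SFinite μ] {p q : ℝ}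
    (hpq : p.HolderConjugate q) {k : α → α → ℝ≥0∞} (hk : Measurable (Function.uncurry k))
    {h : α → ℝ≥0∞} (hh : Measurable h) (hh0 : ∀ᵐ w ∂μ, h w ≠ 0 ∧ h w ≠ ⊤) {C : ℝ≥0∞}
    (H1 : ∀ᵐ z ∂μ, ∫⁻ w, k z w * h w ^ q ∂μ ≤ C * h z ^ q)
    (H2 : ∀ᵐ w ∂μ, ∫⁻ z, k z w * h z ^ p ∂μ ≤ C * h w ^ p)
    {f : α → ℝ≥0∞} (hf : AEMeasurable f μ) :
    ∫⁻ z, (∫⁻ w, k z w * f w ∂μ) ^ p ∂μ ≤ C ^ p * ∫⁻ w, f w ^ p ∂μ := by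
  have hp := hpq.pos
  have hq := hpq.symm.pos
  have hkz : ∀ z, Measurable (k z) := fun z => hk.comp measurable_prodMk_left
  have hkw : ∀ w, Measurable fun z => k z w := fun w => hk.comp measurable_prodMk_right
  have step : ∀ᵐ z ∂μ, (∫⁻ w, k z w * f w ∂μ) ^ p ≤
      C ^ (p / q) * ∫⁻ w, h z ^ p * (k z w * ((h w)⁻¹ ^ p * f w ^ p)) ∂μ := by
    filter_upwards [H1] with z hz
    -- Splitting `k f = (k^(1/p) h⁻¹ f) (k^(1/q) h)` prepares Hölder's inequality, whose second
    -- factor is controlled by `H1`.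
    have h1 : ∫⁻ w, k z w * f w ∂μ =
        ∫⁻ w, ((fun w => k z w ^ (1 / p) * ((h w)⁻¹ * f w)) * fun w => k z w ^ (1 / q) * h w) w
          ∂μ := by
      refine lintegral_congr_ae ?_
      filter_upwards [hh0] with w hw
      simp only [Pi.mul_apply]
      have : k z w = k z w ^ (1 / p) * k z w ^ (1 / q) := by
        rw [← ENNReal.rpow_add_of_nonneg _ _ (by positivity) (by positivity), one_div, one_div,
          hpq.inv_add_inv_eq_one, ENNReal.rpow_one]
      calc k z w * f w = (k z w ^ (1 / p) * k z w ^ (1 / q)) * f w * ((h w)⁻¹ * h w) := by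
            rw [ENNReal.inv_mul_cancel hw.1 hw.2, mul_one, ← this]
        _ = _ := by ring
    rw [h1]
    have h2 := ENNReal.lintegral_mul_le_Lp_mul_Lq μ hpq
      (f := fun w => k z w ^ (1 / p) * ((h w)⁻¹ * f w)) (g := fun w => k z w ^ (1 / q) * h w)
      (((hkz z).pow_const _).aemeasurable.mul (hh.inv.aemeasurable.mul hf))
      (((hkz z).pow_const _).mul hh).aemeasurable
    refine (ENNReal.rpow_le_rpow h2 hp.le).trans ?_
    rw [ENNReal.mul_rpow_of_nonneg _ _ hp.le, ← ENNReal.rpow_mul, ← ENNReal.rpow_mul,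
      one_div_mul_cancel hp.ne', ENNReal.rpow_one]
    have h3 : ∫⁻ w, (k z w ^ (1 / q) * h w) ^ q ∂μ ≤ C * h z ^ q := by
      refine le_trans (le_of_eq (lintegral_congr fun w => ?_)) hz
      rw [ENNReal.mul_rpow_of_nonneg _ _ hq.le, ← ENNReal.rpow_mul, one_div_mul_cancel hq.ne',
        ENNReal.rpow_one]
    have h4 : ∀ w, (k z w ^ (1 / p) * ((h w)⁻¹ * f w)) ^ p = k z w * ((h w)⁻¹ ^ p * f w ^ p) := by
      intro w
      rw [ENNReal.mul_rpow_of_nonneg _ _ hp.le, ENNReal.mul_rpow_of_nonneg _ _ hp.le,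
        ← ENNReal.rpow_mul, one_div_mul_cancel hp.ne', ENNReal.rpow_one]
    simp_rw [h4]
    refine (mul_le_mul_right (ENNReal.rpow_le_rpow h3 (by positivity)) _).trans (le_of_eq ?_)
    rw [ENNReal.mul_rpow_of_nonneg _ _ (by positivity), ← ENNReal.rpow_mul,
      show q * (1 / q * p) = p by field_simp, show 1 / q * p = p / q by ring,
      lintegral_const_mul'' _ (show AEMeasurable (fun w => k z w * ((h w)⁻¹ ^ p * f w ^ p)) μ from
        (hkz z).aemeasurable.mul ((hh.inv.pow_const p).aemeasurable.mul (hf.pow_const p)))]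
    ring
  refine (lintegral_mono_ae step).trans ?_
  have hmeas : AEMeasurable (Function.uncurry fun z w => h z ^ p * (k z w * ((h w)⁻¹ ^ p * f w ^ p)))
      (μ.prod μ) := by
    refine ((hh.comp measurable_fst).pow_const p).aemeasurable.mul (hk.aemeasurable.mul
      (((hh.comp measurable_snd).inv.pow_const p).aemeasurable.mul ?_))
    exact (hf.comp_quasiMeasurePreserving Measure.quasiMeasurePreserving_snd).pow_const p
  -- Hölder and `H1` contribute `C^(p/q)`, Tonelli and `H2` contribute `C`, and `p/q + 1 = p`.
  have hpc : C ^ p = C ^ (p / q) * C := by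
    have : p = p / q + 1 := by
      have := hpq.inv_add_inv_eq_one
      field_simp at this ⊢
      linarith
    conv_lhs => rw [this, ENNReal.rpow_add_of_nonneg _ _ (by positivity) zero_le_one,
      ENNReal.rpow_one]
  rw [lintegral_const_mul'' _ (show AEMeasurable (fun z => ∫⁻ w, h z ^ p *
    (k z w * ((h w)⁻¹ ^ p * f w ^ p)) ∂μ) μ from hmeas.lintegral_prod_right'),
    lintegral_lintegral_swap hmeas, hpc,
    mul_assoc]
  refine mul_le_mul_right ?_ _
  rw [← lintegral_const_mul'' _ (hf.pow_const p)]
  refine lintegral_mono_ae ?_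
  filter_upwards [H2, hh0] with w hw hw0
  calc ∫⁻ z, h z ^ p * (k z w * ((h w)⁻¹ ^ p * f w ^ p)) ∂μ
      = ∫⁻ z, (k z w * h z ^ p) * ((h w)⁻¹ ^ p * f w ^ p) ∂μ := lintegral_congr fun z => by ring
    _ = (∫⁻ z, k z w * h z ^ p ∂μ) * ((h w)⁻¹ ^ p * f w ^ p) :=
        lintegral_mul_const _ ((hkw w).mul (hh.pow_const p))
    _ ≤ (C * h w ^ p) * ((h w)⁻¹ ^ p * f w ^ p) := mul_le_mul_left hw _
    _ = C * f w ^ p * (h w * (h w)⁻¹) ^ p := by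
        rw [ENNReal.mul_rpow_of_nonneg _ _ hp.le]; ring
    _ = C * f w ^ p := by rw [ENNReal.mul_inv_cancel hw0.1 hw0.2, ENNReal.one_rpow, mul_one]

/-! ### The measure on the punctured bidisc -/

/-- Lebesgue measure on `𝔻* × 𝔻`. -/
noncomputable abbrev puncturedBidiscMeasure : Measure (ℂ × ℂ) :=
  volume.restrict (puncturedBidisc : Set (ℂ × ℂ))

theorem coe_bidisc : (bidisc : Set (ℂ × ℂ)) = ball (0 : ℂ) 1 ×ˢ ball (0 : ℂ) 1 := by
  ext w
  simp [bidisc]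

theorem puncturedBidisc_le_bidisc : puncturedBidisc ≤ bidisc := fun _ hw => hw.2

theorem coe_puncturedBidisc :
    (puncturedBidisc : Set (ℂ × ℂ)) = (ball (0 : ℂ) 1 \ {0}) ×ˢ ball (0 : ℂ) 1 := by
  ext w
  simp [puncturedBidisc]
  tauto

theorem volume_restrict_bidisc : volume.restrict (bidisc : Set (ℂ × ℂ)) =
    (volume.restrict (ball (0 : ℂ) 1)).prod (volume.restrict (ball (0 : ℂ) 1)) := by
  rw [coe_bidisc, Measure.volume_eq_prod, Measure.prod_restrict]

theorem restrict_punctured_unitDisc :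
    volume.restrict (ball (0 : ℂ) 1 \ {0}) = volume.restrict (ball (0 : ℂ) 1) :=
  Measure.restrict_congr_set (sdiff_null_ae_eq_self (by simp))

theorem puncturedBidiscMeasure_eq_prod : puncturedBidiscMeasure =
    (volume.restrict (ball (0 : ℂ) 1)).prod (volume.restrict (ball (0 : ℂ) 1)) := by
  rw [puncturedBidiscMeasure, coe_puncturedBidisc, Measure.volume_eq_prod, ← Measure.prod_restrict,
    restrict_punctured_unitDisc]

/-- The removed set `{0} × 𝔻` is null; this is what makes restriction isometric. -/
theorem puncturedBidiscMeasure_eq_restrict_bidisc :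
    puncturedBidiscMeasure = volume.restrict (bidisc : Set (ℂ × ℂ)) := by
  rw [puncturedBidiscMeasure_eq_prod, volume_restrict_bidisc]

instance isFiniteMeasure_unitDisc : IsFiniteMeasure (volume.restrict (ball (0 : ℂ) 1)) :=
  ⟨by simp [Complex.volume_ball]⟩

instance isFiniteMeasure_puncturedBidisc : IsFiniteMeasure puncturedBidiscMeasure := by
  rw [puncturedBidiscMeasure_eq_prod]
  infer_instance

theorem ae_mem_puncturedBidisc : ∀ᵐ w ∂puncturedBidiscMeasure, w ∈ puncturedBidisc :=
  ae_restrict_mem puncturedBidisc.isOpen.measurableSet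

/-! ### Integral operators with kernels `φ(z₁ w̄₁) ψ(z₂ w̄₂)` -/

/-- The integral operator on `𝔻* × 𝔻` with kernel `φ (z₁ w̄₁) ψ (z₂ w̄₂) / π²`. -/
noncomputable def sesquiIntegral (φ ψ : ℂ → ℂ) (f : ℂ × ℂ → ℂ) (z : ℂ × ℂ) : ℂ :=
  ((Real.pi : ℂ) ^ 2)⁻¹ * ∫ w, φ (z.1 * conj w.1) * ψ (z.2 * conj w.2) * f w
    ∂puncturedBidiscMeasure

theorem mul_conj_mem_unitBall {z w : ℂ} (hz : ‖z‖ < 1) (hw : ‖w‖ < 1) :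
    z * conj w ∈ ball (0 : ℂ) 1 := by
  rw [mem_ball_zero_iff, norm_mul, RCLike.norm_conj]
  nlinarith [norm_nonneg z, norm_nonneg w]

theorem exists_bound_on_smaller_disc {φ : ℂ → ℂ} (hφ : DifferentiableOn ℂ φ (ball 0 1))
    {ρ : ℝ} (hρ : ρ < 1) :
    ∃ C : ℝ, 0 ≤ C ∧ ∀ u : ℂ, ‖u‖ ≤ ρ → ‖φ u‖ ≤ C ∧ ‖deriv φ u‖ ≤ C := by
  have hsub : closedBall (0 : ℂ) ρ ⊆ ball 0 1 := closedBall_subset_ball hρ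
  obtain ⟨C₁, h1⟩ := (isCompact_closedBall (0 : ℂ) ρ).exists_bound_of_continuousOn
    (hφ.continuousOn.mono hsub)
  obtain ⟨C₂, h2⟩ := (isCompact_closedBall (0 : ℂ) ρ).exists_bound_of_continuousOn
    ((hφ.deriv isOpen_ball).continuousOn.mono hsub)
  refine ⟨max 0 (max C₁ C₂), le_max_left _ _, fun u hu => ⟨?_, ?_⟩⟩
  · exact (h1 u (by simpa using hu)).trans ((le_max_left _ _).trans (le_max_right _ _))
  · exact (h2 u (by simpa using hu)).trans ((le_max_right _ _).trans (le_max_right _ _))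

theorem norm_mul_conj_le {z w : ℂ} (hw : ‖w‖ < 1) : ‖z * conj w‖ ≤ ‖z‖ := by
  rw [norm_mul, RCLike.norm_conj]
  exact mul_le_of_le_one_right (norm_nonneg _) hw.le

theorem continuousOn_comp_mul_conj_fst {φ : ℂ → ℂ} (hφ : DifferentiableOn ℂ φ (ball 0 1))
    {z : ℂ} (hz : ‖z‖ < 1) :
    ContinuousOn (fun w : ℂ × ℂ => φ (z * conj w.1)) puncturedBidisc := by
  have : Continuous fun w : ℂ × ℂ => z * conj w.1 := by fun_prop
  exact hφ.continuousOn.comp this.continuousOn fun w hw => mul_conj_mem_unitBall hz hw.2.1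

theorem continuousOn_comp_mul_conj_snd {φ : ℂ → ℂ} (hφ : DifferentiableOn ℂ φ (ball 0 1))
    {z : ℂ} (hz : ‖z‖ < 1) :
    ContinuousOn (fun w : ℂ × ℂ => φ (z * conj w.2)) puncturedBidisc := by
  have : Continuous fun w : ℂ × ℂ => z * conj w.2 := by fun_prop
  exact hφ.continuousOn.comp this.continuousOn fun w hw => mul_conj_mem_unitBall hz hw.2.2

theorem exists_sesqui_kernel_bound {φ ψ : ℂ → ℂ} (hφ : DifferentiableOn ℂ φ (ball 0 1))
    (hψ : DifferentiableOn ℂ ψ (ball 0 1))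
    {z : ℂ × ℂ} (hz : z ∈ bidisc) :
    ∃ C : ℝ, ∀ w ∈ puncturedBidisc, ‖φ (z.1 * conj w.1) * ψ (z.2 * conj w.2)‖ ≤ C := by
  obtain ⟨C, hC0, hC⟩ := exists_bound_on_smaller_disc hφ hz.1
  obtain ⟨D, hD0, hD⟩ := exists_bound_on_smaller_disc hψ hz.2
  refine ⟨C * D, fun w hw => ?_⟩
  rw [norm_mul]
  exact mul_le_mul (hC _ (norm_mul_conj_le hw.2.1)).1 (hD _ (norm_mul_conj_le hw.2.2)).1
    (norm_nonneg _) hC0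

theorem aestronglyMeasurable_sesqui_kernel {φ ψ : ℂ → ℂ} (hφ : DifferentiableOn ℂ φ (ball 0 1))
    (hψ : DifferentiableOn ℂ ψ (ball 0 1))
    {z : ℂ × ℂ} (hz : z ∈ bidisc) :
    AEStronglyMeasurable (fun w : ℂ × ℂ => φ (z.1 * conj w.1) * ψ (z.2 * conj w.2))
      puncturedBidiscMeasure :=
  ((continuousOn_comp_mul_conj_fst hφ hz.1).mul
    (continuousOn_comp_mul_conj_snd hψ hz.2)).aestronglyMeasurable
    puncturedBidisc.isOpen.measurableSet

theorem integrable_sesqui_kernel_mul {φ ψ : ℂ → ℂ} (hφ : DifferentiableOn ℂ φ (ball 0 1))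
    (hψ : DifferentiableOn ℂ ψ (ball 0 1))
    {z : ℂ × ℂ} (hz : z ∈ bidisc) {f : ℂ × ℂ → ℂ}
    (hf : Integrable f puncturedBidiscMeasure) :
    Integrable (fun w : ℂ × ℂ => φ (z.1 * conj w.1) * ψ (z.2 * conj w.2) * f w)
      puncturedBidiscMeasure := by
  obtain ⟨C, hC⟩ := exists_sesqui_kernel_bound hφ hψ hz
  exact hf.bdd_mul (aestronglyMeasurable_sesqui_kernel hφ hψ hz)
    (ae_mem_puncturedBidisc.mono fun w hw => hC w hw)

/-- Holomorphy holds on the whole bidisc although `f` lives on `𝔻* × 𝔻`; this later provides the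
extension across `w₁ = 0`. For `|z₁|, |z₂| < ρ < 1` the arguments `zⱼ w̄ⱼ` stay in a compact disc,
so the kernel and its derivatives are bounded and one may differentiate under the integral. -/
theorem differentiableOn_sesquiIntegral {φ ψ : ℂ → ℂ} (hφ : DifferentiableOn ℂ φ (ball 0 1))
    (hψ : DifferentiableOn ℂ ψ (ball 0 1))
    {f : ℂ × ℂ → ℂ}
    (hf : Integrable f puncturedBidiscMeasure) :
    DifferentiableOn ℂ (sesquiIntegral φ ψ f) bidisc := by
  intro z hz
  refine DifferentiableAt.differentiableWithinAt (DifferentiableAt.const_mul ?_ _)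
  obtain ⟨ρ, hρ, hρ1⟩ := exists_between (max_lt hz.1 hz.2)
  obtain ⟨C, hC0, hC⟩ := exists_bound_on_smaller_disc hφ hρ1
  obtain ⟨D, hD0, hD⟩ := exists_bound_on_smaller_disc hψ hρ1
  have hs : {y : ℂ × ℂ | ‖y.1‖ < ρ ∧ ‖y.2‖ < ρ} ∈ 𝓝 z := by
    refine IsOpen.mem_nhds ?_ ⟨(le_max_left _ _).trans_lt hρ, (le_max_right _ _).trans_lt hρ⟩
    refine IsOpen.and ?_ ?_ <;> exact isOpen_lt (by fun_prop) (by fun_prop)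
  have hsub : ∀ y ∈ {y : ℂ × ℂ | ‖y.1‖ < ρ ∧ ‖y.2‖ < ρ}, y ∈ bidisc := fun y hy =>
    ⟨hy.1.trans hρ1, hy.2.trans hρ1⟩
  refine (hasFDerivAt_integral_of_dominated_of_fderiv_le (bound := fun w => (2 * C * D) * ‖f w‖)
    (F' := fun y w => f w • ((φ (y.1 * conj w.1) * (deriv ψ (y.2 * conj w.2) * conj w.2)) •
      ContinuousLinearMap.snd ℂ ℂ ℂ + (ψ (y.2 * conj w.2) * (deriv φ (y.1 * conj w.1) * conj w.1)) •
      ContinuousLinearMap.fst ℂ ℂ ℂ)) hs ?_ ?_ ?_ ?_ (hf.norm.const_mul _) ?_).differentiableAt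
  · filter_upwards [hs] with y hy
    exact (integrable_sesqui_kernel_mul hφ hψ (hsub y hy) hf).aestronglyMeasurable
  · exact integrable_sesqui_kernel_mul hφ hψ hz hf
  · have m1 := (continuousOn_comp_mul_conj_fst hφ hz.1).mul
      ((continuousOn_comp_mul_conj_snd (hψ.deriv isOpen_ball) hz.2).mul
      (by fun_prop : ContinuousOn (fun w : ℂ × ℂ => conj w.2) puncturedBidisc))
    have m2 := (continuousOn_comp_mul_conj_snd hψ hz.2).mul
      ((continuousOn_comp_mul_conj_fst (hφ.deriv isOpen_ball) hz.1).mul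
      (by fun_prop : ContinuousOn (fun w : ℂ × ℂ => conj w.1) puncturedBidisc))
    exact hf.aestronglyMeasurable.smul (((m1.smul continuousOn_const).add
      (m2.smul continuousOn_const)).aestronglyMeasurable puncturedBidisc.isOpen.measurableSet)
  · filter_upwards [ae_mem_puncturedBidisc] with w hw y hy
    have c1 := hC (y.1 * conj w.1) ((norm_mul_conj_le hw.2.1).trans hy.1.le)
    have c2 := hD (y.2 * conj w.2) ((norm_mul_conj_le hw.2.2).trans hy.2.le)
    have hw1 : ‖conj w.1‖ ≤ 1 := by rw [RCLike.norm_conj]; exact hw.2.1.le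
    have hw2 : ‖conj w.2‖ ≤ 1 := by rw [RCLike.norm_conj]; exact hw.2.2.le
    rw [norm_smul, mul_comm]
    refine mul_le_mul_of_nonneg_right ?_ (norm_nonneg _)
    refine (norm_add_le _ _).trans ?_
    rw [norm_smul, norm_smul, norm_mul, norm_mul, norm_mul, norm_mul]
    calc _ ≤ C * (D * 1) * 1 + D * (C * 1) * 1 := by
          gcongr
          · exact c1.1
          · exact c2.2
          · exact ContinuousLinearMap.norm_snd_le ..
          · exact c2.1
          · exact c1.2
          · exact ContinuousLinearMap.norm_fst_le ..
      _ = 2 * C * D := by ring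
  · filter_upwards [ae_mem_puncturedBidisc] with w hw y hy
    have d1 : HasFDerivAt (fun y : ℂ × ℂ => φ (y.1 * conj w.1))
        ((deriv φ (y.1 * conj w.1) * conj w.1) • ContinuousLinearMap.fst ℂ ℂ ℂ) y := by
      have hm := isOpen_ball.mem_nhds (mul_conj_mem_unitBall (hsub y hy).1 hw.2.1)
      have h1 := (hφ.differentiableAt hm).hasDerivAt.comp_hasFDerivAt y
        ((hasFDerivAt_fst (𝕜 := ℂ) (p := y)).mul_const (conj w.1))
      simpa [smul_smul, Function.comp_def] using h1
    have d2 : HasFDerivAt (fun y : ℂ × ℂ => ψ (y.2 * conj w.2))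
        ((deriv ψ (y.2 * conj w.2) * conj w.2) • ContinuousLinearMap.snd ℂ ℂ ℂ) y := by
      have hm := isOpen_ball.mem_nhds (mul_conj_mem_unitBall (hsub y hy).2 hw.2.2)
      have h1 := (hψ.differentiableAt hm).hasDerivAt.comp_hasFDerivAt y
        ((hasFDerivAt_snd (𝕜 := ℂ) (p := y)).mul_const (conj w.2))
      simpa [smul_smul, Function.comp_def] using h1
    have := (d1.mul d2).mul_const (f w)
    simpa [smul_smul] using this

/-- The coefficients of `φ` and `ψ` enter only as factors of a moment of `f`. Hence replacing `φ` by
a series with multiplied coefficients acts on the result as a Taylor multiplier. -/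
theorem hasTaylorExpansion_sesquiIntegral {φ ψ : ℂ → ℂ} {c d : ℕ → ℂ}
    (hφ : ∀ u ∈ ball (0 : ℂ) 1, HasSum (fun n => c n * u ^ n) (φ u))
    (hψ : ∀ u ∈ ball (0 : ℂ) 1, HasSum (fun n => d n * u ^ n) (ψ u)) {f : ℂ × ℂ → ℂ}
    (hf : Integrable f puncturedBidiscMeasure) :
    HasTaylorExpansion (sesquiIntegral φ ψ f) (fun m n => c m * (d n * (((Real.pi : ℂ) ^ 2)⁻¹ *
      ∫ w, conj w.1 ^ m * conj w.2 ^ n * f w ∂puncturedBidiscMeasure))) := by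
  intro z hz
  have hz1 : ‖z.1‖ < 1 := hz.1
  have hz2 : ‖z.2‖ < 1 := hz.2
  have hF_int : ∀ i : ℕ × ℕ, Integrable (fun w : ℂ × ℂ => (c i.1 * (z.1 * conj w.1) ^ i.1) *
      (d i.2 * (z.2 * conj w.2) ^ i.2) * f w) puncturedBidiscMeasure := fun i =>
    integrable_sesqui_kernel_mul (φ := fun u => c i.1 * u ^ i.1) (ψ := fun u => d i.2 * u ^ i.2)
      (by fun_prop) (by fun_prop) hz hf
  have hs1 := (hφ z.1 (by simpa using hz1)).summable.norm
  have hs2 := (hψ z.2 (by simpa using hz2)).summable.norm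
  have hsum : Summable fun i : ℕ × ℕ => ∫ w, ‖(c i.1 * (z.1 * conj w.1) ^ i.1) *
      (d i.2 * (z.2 * conj w.2) ^ i.2) * f w‖ ∂puncturedBidiscMeasure := by
    refine Summable.of_nonneg_of_le (fun i => integral_nonneg fun w => norm_nonneg _) (fun i => ?_)
      ((hs1.mul_of_nonneg hs2 (fun _ => norm_nonneg _) fun _ => norm_nonneg _).mul_right
        (∫ w, ‖f w‖ ∂puncturedBidiscMeasure))
    rw [← integral_const_mul]
    refine integral_mono_ae (hF_int i).norm (hf.norm.const_mul _) ?_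
    filter_upwards [ae_mem_puncturedBidisc] with w hw
    simp only [norm_mul, norm_pow, RCLike.norm_conj]
    have h1 : ‖z.1‖ * ‖w.1‖ ≤ ‖z.1‖ := mul_le_of_le_one_right (norm_nonneg _) hw.2.1.le
    have h2 : ‖z.2‖ * ‖w.2‖ ≤ ‖z.2‖ := mul_le_of_le_one_right (norm_nonneg _) hw.2.2.le
    gcongr
  have h := (hasSum_integral_of_summable_integral_norm hF_int hsum).mul_left
    (((Real.pi : ℂ) ^ 2)⁻¹)
  have e1 : ((Real.pi : ℂ) ^ 2)⁻¹ * ∫ w, ∑' i : ℕ × ℕ, (c i.1 * (z.1 * conj w.1) ^ i.1) *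
      (d i.2 * (z.2 * conj w.2) ^ i.2) * f w ∂puncturedBidiscMeasure = sesquiIntegral φ ψ f z := by
    rw [sesquiIntegral]
    congr 1
    refine integral_congr_ae ?_
    filter_upwards [ae_mem_puncturedBidisc] with w hw
    have t1 := hφ _ (mul_conj_mem_unitBall hz1 hw.2.1)
    have t2 := hψ _ (mul_conj_mem_unitBall hz2 hw.2.2)
    rw [tsum_mul_right, ← t1.tsum_eq, ← t2.tsum_eq,
      tsum_mul_tsum_of_summable_norm t1.summable.norm t2.summable.norm]
  rw [e1] at h
  have e2 : ∀ i : ℕ × ℕ, ((Real.pi : ℂ) ^ 2)⁻¹ * ∫ w, (c i.1 * (z.1 * conj w.1) ^ i.1) *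
      (d i.2 * (z.2 * conj w.2) ^ i.2) * f w ∂puncturedBidiscMeasure =
      c i.1 * (d i.2 * (((Real.pi : ℂ) ^ 2)⁻¹ *
        ∫ w, conj w.1 ^ i.1 * conj w.2 ^ i.2 * f w ∂puncturedBidiscMeasure)) *
        z.1 ^ i.1 * z.2 ^ i.2 := by
    intro i
    have : ∀ w : ℂ × ℂ, (c i.1 * (z.1 * conj w.1) ^ i.1) * (d i.2 * (z.2 * conj w.2) ^ i.2) * f w =
        (c i.1 * z.1 ^ i.1 * (d i.2 * z.2 ^ i.2)) * (conj w.1 ^ i.1 * conj w.2 ^ i.2 * f w) :=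
      fun w => by rw [mul_pow, mul_pow]; ring
    simp_rw [this]
    rw [integral_const_mul]
    ring
  simpa only [e2] using h

/-! ### The Bergman kernel and the kernel of the multiplier -/

/-- The function `(1 - u)⁻²`: the Bergman kernel of the disc is `discKernel (z w̄) / π`. -/
noncomputable def discKernel (u : ℂ) : ℂ := ((1 - u) ^ 2)⁻¹

/-- The function `(1 - u)⁻² + (1 - u)⁻¹ = ∑ (n + 2) uⁿ`. -/
noncomputable def multiplierKernel (u : ℂ) : ℂ := discKernel u + (1 - u)⁻¹

theorem one_sub_ne_zero_of_mem_unitBall {u : ℂ} (hu : u ∈ ball (0 : ℂ) 1) : 1 - u ≠ 0 := by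
  intro h
  rw [← sub_eq_zero.1 h] at hu
  simp at hu

theorem differentiableOn_discKernel : DifferentiableOn ℂ discKernel (ball 0 1) := by
  unfold discKernel
  exact DifferentiableOn.inv (by fun_prop) fun u hu =>
    pow_ne_zero 2 (one_sub_ne_zero_of_mem_unitBall hu)

theorem differentiableOn_multiplierKernel : DifferentiableOn ℂ multiplierKernel (ball 0 1) :=
  differentiableOn_discKernel.add
    (DifferentiableOn.inv (by fun_prop) fun _ hu => one_sub_ne_zero_of_mem_unitBall hu)

theorem measurable_discKernel : Measurable discKernel := by
  unfold discKernel
  fun_prop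

theorem hasSum_discKernel {u : ℂ} (hu : u ∈ ball (0 : ℂ) 1) :
    HasSum (fun n : ℕ => ((n : ℂ) + 1) * u ^ n) (discKernel u) := by
  have h1 := hasSum_coe_mul_geometric_of_norm_lt_one (mem_ball_zero_iff.1 hu)
  have h2 := hasSum_geometric_of_norm_lt_one (mem_ball_zero_iff.1 hu)
  have h := h1.add h2
  have h0 := one_sub_ne_zero_of_mem_unitBall hu
  rw [show u / (1 - u) ^ 2 + (1 - u)⁻¹ = discKernel u by
    rw [discKernel]; field_simp; ring] at h
  simpa only [add_mul, one_mul] using h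

theorem hasSum_multiplierKernel {u : ℂ} (hu : u ∈ ball (0 : ℂ) 1) :
    HasSum (fun n : ℕ => (1 + 1 / ((n : ℂ) + 1)) * ((n : ℂ) + 1) * u ^ n) (multiplierKernel u) := by
  have h := (hasSum_discKernel hu).add (hasSum_geometric_of_norm_lt_one (mem_ball_zero_iff.1 hu))
  have e : ∀ n : ℕ, (1 + 1 / ((n : ℂ) + 1)) * ((n : ℂ) + 1) * u ^ n =
      ((n : ℂ) + 1) * u ^ n + u ^ n := by
    intro n
    have : (n : ℂ) + 1 ≠ 0 := by exact_mod_cast n.succ_ne_zero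
    field_simp
  simpa only [e, multiplierKernel] using h

/-- `(1 - u)⁻¹` is `1 - u` times `discKernel u`, and `|1 - u| ≤ 2`. -/
theorem norm_multiplierKernel_le {u : ℂ} (hu : u ∈ ball (0 : ℂ) 1) :
    ‖multiplierKernel u‖ ≤ 3 * ‖discKernel u‖ := by
  have h0 := one_sub_ne_zero_of_mem_unitBall hu
  have h1 : (1 - u)⁻¹ = (1 - u) * discKernel u := by
    rw [discKernel]; field_simp
  have h2 : ‖1 - u‖ ≤ 2 := by
    refine (norm_sub_le _ _).trans ?_
    have := (mem_ball_zero_iff.1 hu).le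
    rw [norm_one]
    linarith
  rw [multiplierKernel]
  refine (norm_add_le _ _).trans ?_
  rw [h1, norm_mul]
  nlinarith [norm_nonneg (discKernel u)]

theorem norm_discKernel_mul_conj_comm (z w : ℂ) :
    ‖discKernel (z * conj w)‖ = ‖discKernel (w * conj z)‖ := by
  rw [← RCLike.norm_conj, discKernel, discKernel]
  congr 1
  simp [mul_comm]

/-! ### Boundedness on `L^p` -/

theorem exists_bidisc_forelli_rudin_bound {a : ℝ} (h0 : 0 < a) (h1 : a < 1) :
    ∃ C : ℝ≥0, ∀ z ∈ bidisc,
    ∫⁻ w, ‖discKernel (z.1 * conj w.1)‖ₑ * ‖discKernel (z.2 * conj w.2)‖ₑ *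
      (ENNReal.ofReal (1 - ‖w.1‖) ^ (-a) * ENNReal.ofReal (1 - ‖w.2‖) ^ (-a))
        ∂puncturedBidiscMeasure ≤
      C * (ENNReal.ofReal (1 - ‖z.1‖) ^ (-a) * ENNReal.ofReal (1 - ‖z.2‖) ^ (-a)) := by
  obtain ⟨C, hC⟩ := exists_forelli_rudin_bound h0 h1
  refine ⟨C * C, fun z hz => ?_⟩
  have hm : ∀ v : ℂ, Measurable fun w : ℂ =>
      ‖discKernel (v * conj w)‖ₑ * ENNReal.ofReal (1 - ‖w‖) ^ (-a) := fun v => by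
    unfold discKernel
    fun_prop
  have := lintegral_prod_mul (μ := volume.restrict (ball (0 : ℂ) 1))
    (ν := volume.restrict (ball (0 : ℂ) 1)) (hm z.1).aemeasurable (hm z.2).aemeasurable
  rw [puncturedBidiscMeasure_eq_prod]
  calc _ = _ := lintegral_congr fun w => by ring
    _ = _ := this
    _ ≤ _ := mul_le_mul' (hC z.1 hz.1) (hC z.2 hz.2)
    _ = _ := by push_cast; ring

theorem exists_lintegral_bergman_kernel_bound {p : ℝ} (hp : 1 < p) : ∃ C : ℝ≥0,
    ∀ f : ℂ × ℂ → ℝ≥0∞, AEMeasurable f puncturedBidiscMeasure →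
      ∫⁻ z, (∫⁻ w, ‖discKernel (z.1 * conj w.1)‖ₑ * ‖discKernel (z.2 * conj w.2)‖ₑ * f w
        ∂puncturedBidiscMeasure) ^ p ∂puncturedBidiscMeasure ≤
      (C : ℝ≥0∞) ^ p * ∫⁻ w, f w ^ p ∂puncturedBidiscMeasure := by
  obtain ⟨q, hpq⟩ : ∃ q, p.HolderConjugate q := ⟨_, Real.HolderConjugate.conjExponent hp⟩
  have hp0 := hpq.pos
  have hq0 := hpq.symm.pos
  have hq1 := hpq.symm.lt
  obtain ⟨C₁, h1⟩ := exists_bidisc_forelli_rudin_bound (a := 1 / p) (by positivity)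
    (by rw [div_lt_one hp0]; exact hp)
  obtain ⟨C₂, h2⟩ := exists_bidisc_forelli_rudin_bound (a := 1 / q) (by positivity)
    (by rw [div_lt_one hq0]; exact hq1)
  -- With exponent `-1/(pq)`, the powers `h^q` and `h^p` have exponents `-1/p` and `-1/q`, both in
  -- the range `(-1, 0)` of the Forelli–Rudin estimate.
  obtain ⟨h, hh⟩ : ∃ h : ℂ × ℂ → ℝ≥0∞, h = fun w => ENNReal.ofReal (1 - ‖w.1‖) ^ (-(1 / (p * q))) *
    ENNReal.ofReal (1 - ‖w.2‖) ^ (-(1 / (p * q))) := ⟨_, rfl⟩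
  have hhq : ∀ w, h w ^ q = ENNReal.ofReal (1 - ‖w.1‖) ^ (-(1 / p)) *
      ENNReal.ofReal (1 - ‖w.2‖) ^ (-(1 / p)) := fun w => by
    simp only [hh]
    rw [ENNReal.mul_rpow_of_nonneg _ _ hq0.le, ← ENNReal.rpow_mul, ← ENNReal.rpow_mul,
      show -(1 / (p * q)) * q = -(1 / p) by field_simp]
  have hhp : ∀ w, h w ^ p = ENNReal.ofReal (1 - ‖w.1‖) ^ (-(1 / q)) *
      ENNReal.ofReal (1 - ‖w.2‖) ^ (-(1 / q)) := fun w => by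
    simp only [hh]
    rw [ENNReal.mul_rpow_of_nonneg _ _ hp0.le, ← ENNReal.rpow_mul, ← ENNReal.rpow_mul,
      show -(1 / (p * q)) * p = -(1 / q) by field_simp]
  have hk : Measurable (Function.uncurry fun z w : ℂ × ℂ =>
      ‖discKernel (z.1 * conj w.1)‖ₑ * ‖discKernel (z.2 * conj w.2)‖ₑ) := by
    have m1 : Measurable fun x : (ℂ × ℂ) × ℂ × ℂ => x.1.1 * conj x.2.1 := by fun_prop
    have m2 : Measurable fun x : (ℂ × ℂ) × ℂ × ℂ => x.1.2 * conj x.2.2 := by fun_prop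
    exact (measurable_discKernel.comp m1).enorm.mul (measurable_discKernel.comp m2).enorm
  have hhm : Measurable h := by
    rw [hh]
    fun_prop
  have hh0 : ∀ᵐ w ∂puncturedBidiscMeasure, h w ≠ 0 ∧ h w ≠ ⊤ := by
    filter_upwards [ae_mem_puncturedBidisc] with w hw
    have p1 : 0 < 1 - ‖w.1‖ := by linarith [hw.2.1]
    have p2 : 0 < 1 - ‖w.2‖ := by linarith [hw.2.2]
    simp only [hh]
    rw [ENNReal.ofReal_rpow_of_pos p1, ENNReal.ofReal_rpow_of_pos p2,
      ← ENNReal.ofReal_mul (by positivity)]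
    exact ⟨by simpa using mul_pos (Real.rpow_pos_of_pos p1 _) (Real.rpow_pos_of_pos p2 _),
      ENNReal.ofReal_ne_top⟩
  have H1 : ∀ᵐ z ∂puncturedBidiscMeasure, ∫⁻ w, ‖discKernel (z.1 * conj w.1)‖ₑ *
      ‖discKernel (z.2 * conj w.2)‖ₑ * h w ^ q ∂puncturedBidiscMeasure ≤
        ((max C₁ C₂ : ℝ≥0) : ℝ≥0∞) * h z ^ q := by
    filter_upwards [ae_mem_puncturedBidisc] with z hz
    simp_rw [hhq]
    refine (h1 z hz.2).trans (mul_le_mul_left ?_ _)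
    exact_mod_cast le_max_left _ _
  have H2 : ∀ᵐ w ∂puncturedBidiscMeasure, ∫⁻ z, ‖discKernel (z.1 * conj w.1)‖ₑ *
      ‖discKernel (z.2 * conj w.2)‖ₑ * h z ^ p ∂puncturedBidiscMeasure ≤
        ((max C₁ C₂ : ℝ≥0) : ℝ≥0∞) * h w ^ p := by
    filter_upwards [ae_mem_puncturedBidisc] with w hw
    simp_rw [hhp]
    refine le_trans (le_of_eq (lintegral_congr fun z => ?_))
      ((h2 w hw.2).trans (mul_le_mul_left ?_ _))
    · rw [← ofReal_norm, ← ofReal_norm, norm_discKernel_mul_conj_comm z.1,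
        norm_discKernel_mul_conj_comm z.2, ofReal_norm, ofReal_norm]
    · exact_mod_cast le_max_right _ _
  exact ⟨max C₁ C₂, fun f hf => lintegral_schur_test hpq hk hhm hh0 H1 H2 hf⟩

/-- Integral operators with kernel dominated by the Bergman kernel are bounded on `L^p`. -/
theorem exists_eLpNorm_sesquiIntegral_le {p : ℝ} (hp : 1 < p) {φ : ℂ → ℂ} {M : ℝ≥0}
    (hφ : ∀ u ∈ ball (0 : ℂ) 1, ‖φ u‖ ≤ M * ‖discKernel u‖) : ∃ C : ℝ≥0, ∀ f : ℂ × ℂ → ℂ,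
    AEStronglyMeasurable f puncturedBidiscMeasure →
      eLpNorm (sesquiIntegral φ discKernel f) (ENNReal.ofReal p) puncturedBidiscMeasure ≤
        C * eLpNorm f (ENNReal.ofReal p) puncturedBidiscMeasure := by
  obtain ⟨C, hC⟩ := exists_lintegral_bergman_kernel_bound hp
  refine ⟨M * C, fun f hf => ?_⟩
  have hp0 : 0 < p := by linarith
  have hptw : ∀ z ∈ puncturedBidisc, ‖sesquiIntegral φ discKernel f z‖ₑ ≤
      M * ∫⁻ w, ‖discKernel (z.1 * conj w.1)‖ₑ * ‖discKernel (z.2 * conj w.2)‖ₑ * ‖f w‖ₑ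
        ∂puncturedBidiscMeasure := by
    intro z hz
    have hpi : ‖((Real.pi : ℂ) ^ 2)⁻¹‖ₑ ≤ 1 := by
      rw [← ofReal_norm, ENNReal.ofReal_le_one, norm_inv, norm_pow, Complex.norm_real,
        Real.norm_eq_abs, abs_of_pos Real.pi_pos]
      exact inv_le_one_of_one_le₀ (by nlinarith [Real.pi_gt_three])
    rw [sesquiIntegral, enorm_mul]
    refine (mul_le_mul' hpi (enorm_integral_le_lintegral_enorm _)).trans ?_
    rw [one_mul, ← lintegral_const_mul' _ _ ENNReal.coe_ne_top]
    refine lintegral_mono_ae ?_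
    filter_upwards [ae_mem_puncturedBidisc] with w hw
    rw [enorm_mul, enorm_mul, ← mul_assoc, ← mul_assoc]
    refine mul_le_mul' (mul_le_mul' ?_ le_rfl) le_rfl
    have h := hφ _ (mul_conj_mem_unitBall hz.2.1 hw.2.1)
    rw [← ofReal_norm, ← ofReal_norm, ← ENNReal.ofReal_coe_nnreal,
      ← ENNReal.ofReal_mul M.coe_nonneg]
    exact ENNReal.ofReal_le_ofReal h
  have hne : ENNReal.ofReal p ≠ 0 := by simpa using hp0
  rw [eLpNorm_eq_lintegral_rpow_enorm_toReal hne ENNReal.ofReal_ne_top,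
    eLpNorm_eq_lintegral_rpow_enorm_toReal hne ENNReal.ofReal_ne_top, ENNReal.toReal_ofReal hp0.le]
  have hle : ∫⁻ z, ‖sesquiIntegral φ discKernel f z‖ₑ ^ p ∂puncturedBidiscMeasure ≤
      ((M * C : ℝ≥0) : ℝ≥0∞) ^ p * ∫⁻ w, ‖f w‖ₑ ^ p ∂puncturedBidiscMeasure := by
    calc _ ≤ ∫⁻ z, (M : ℝ≥0∞) ^ p * (∫⁻ w, ‖discKernel (z.1 * conj w.1)‖ₑ *
            ‖discKernel (z.2 * conj w.2)‖ₑ * ‖f w‖ₑ ∂puncturedBidiscMeasure) ^ p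
            ∂puncturedBidiscMeasure := by
          refine lintegral_mono_ae ?_
          filter_upwards [ae_mem_puncturedBidisc] with z hz
          rw [← ENNReal.mul_rpow_of_nonneg _ _ hp0.le]
          exact ENNReal.rpow_le_rpow (hptw z hz) hp0.le
      _ = (M : ℝ≥0∞) ^ p * _ := lintegral_const_mul' _ _
          (ENNReal.rpow_ne_top_of_nonneg hp0.le ENNReal.coe_ne_top)
      _ ≤ (M : ℝ≥0∞) ^ p * ((C : ℝ≥0∞) ^ p * ∫⁻ w, ‖f w‖ₑ ^ p ∂puncturedBidiscMeasure) :=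
          mul_le_mul_right (hC _ hf.enorm) _
      _ = _ := by rw [ENNReal.coe_mul, ENNReal.mul_rpow_of_nonneg _ _ hp0.le, mul_assoc]
  refine (ENNReal.rpow_le_rpow hle (by positivity)).trans (le_of_eq ?_)
  rw [ENNReal.mul_rpow_of_nonneg _ _ (by positivity), ← ENNReal.rpow_mul, mul_one_div_cancel hp0.ne',
    ENNReal.rpow_one]

/-! ### The reproducing property and the Bergman projection -/

theorem ae_mem_punctured_unitDisc :
    ∀ᵐ w ∂volume.restrict (ball (0 : ℂ) 1), w ∈ ball (0 : ℂ) 1 \ {0} := by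
  rw [← restrict_punctured_unitDisc]
  exact ae_restrict_mem (measurableSet_ball.diff (measurableSet_singleton 0))

/-- The slice `g (·, ζ)` of a square-integrable holomorphic function on `𝔻* × 𝔻` is
square-integrable. -/
theorem lintegral_slice_sq_ne_top {g : ℂ × ℂ → ℂ} (hg : DifferentiableOn ℂ g puncturedBidisc)
    (h2 : MemLp g 2 puncturedBidiscMeasure) {ζ : ℂ} (hζ : ‖ζ‖ < 1) :
    ∫⁻ w in ball (0 : ℂ) 1, ‖g (w, ζ)‖ₑ ^ 2 ≠ ⊤ := by
  set V := volume (ball ζ (1 - ‖ζ‖))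
  have hV0 : V ≠ 0 := (measure_ball_pos _ _ (by linarith)).ne'
  have hsub : ball ζ (1 - ‖ζ‖) ⊆ ball 0 1 := fun u hu => by
    rw [mem_ball, dist_eq_norm] at hu
    rw [mem_ball_zero_iff]
    linarith [norm_le_norm_add_norm_sub' u ζ]
  have hfin : ∫⁻ w, ‖g w‖ₑ ^ 2 ∂puncturedBidiscMeasure ≠ ⊤ := by
    have := lintegral_rpow_enorm_lt_top_of_eLpNorm_lt_top two_ne_zero ENNReal.ofNat_ne_top h2.2
    simpa using this.ne
  -- This is the sub-mean value property of `g(w, ·)²` on the disc about `ζ` of radius `1 - |ζ|`,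
  -- integrated over `w`. It gives finiteness at every `ζ`, where Fubini alone would give it at
  -- almost every one.
  have hle : V * ∫⁻ w in ball (0 : ℂ) 1, ‖g (w, ζ)‖ₑ ^ 2 ≤
      ∫⁻ w, ‖g w‖ₑ ^ 2 ∂puncturedBidiscMeasure := by
    have hm := h2.1.enorm.pow_const 2
    rw [puncturedBidiscMeasure_eq_prod] at hm ⊢
    rw [lintegral_prod _ hm]
    refine (lintegral_const_mul_le _ _).trans ?_
    refine lintegral_mono_ae ?_
    filter_upwards [ae_mem_punctured_unitDisc] with w hw
    have hd : DifferentiableOn ℂ (fun v => g (w, v)) (ball 0 1) :=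
      hg.comp (by fun_prop) fun v hv => by
        rw [coe_puncturedBidisc]
        exact ⟨hw, hv⟩
    have hb := disc_enorm_bound (f := fun v => g (w, v) ^ 2) ((hd.mono hsub).pow 2)
    simp only [enorm_pow] at hb
    rw [mul_comm]
    exact hb.trans (lintegral_mono_set hsub)
  intro htop
  rw [htop, ENNReal.mul_top hV0] at hle
  exact hfin (top_le_iff.1 hle)

/-- Fubini, with `π s(w)` the value of the inner integral over the second variable. The hypothesis
on `s` assumes integrability of the slice because Fubini supplies it for almost every `w`. -/
theorem sesquiIntegral_iterated {f : ℂ × ℂ → ℂ} (hf : Integrable f puncturedBidiscMeasure)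
    {z : ℂ × ℂ} (hz : z ∈ bidisc) {s : ℂ → ℂ}
    (hs : ∀ᵐ w ∂volume.restrict (ball (0 : ℂ) 1), Integrable (fun v => f (w, v) *
      discKernel (z.2 * conj v)) (volume.restrict (ball (0 : ℂ) 1)) →
      ∫ v in ball (0 : ℂ) 1, f (w, v) * discKernel (z.2 * conj v) = Real.pi * s w) :
    IntegrableOn (fun w => s w * discKernel (z.1 * conj w)) (ball 0 1) ∧
    sesquiIntegral discKernel discKernel f z =
      (Real.pi : ℂ)⁻¹ * ∫ w in ball (0 : ℂ) 1, s w * discKernel (z.1 * conj w) := by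
  have hpi : (Real.pi : ℂ) ≠ 0 := by exact_mod_cast Real.pi_ne_zero
  have hint := integrable_sesqui_kernel_mul differentiableOn_discKernel differentiableOn_discKernel
    hz hf
  rw [puncturedBidiscMeasure_eq_prod] at hint
  have hae : ∀ᵐ w ∂volume.restrict (ball (0 : ℂ) 1),
      ∫ v in ball (0 : ℂ) 1, discKernel (z.1 * conj w) * discKernel (z.2 * conj v) * f (w, v) =
        Real.pi * (s w * discKernel (z.1 * conj w)) := by
    filter_upwards [hint.prod_right_ae, hs, ae_restrict_mem measurableSet_ball] with w hw hsw hwb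
    have hk : discKernel (z.1 * conj w) ≠ 0 := by
      rw [discKernel]
      exact inv_ne_zero (pow_ne_zero 2 (one_sub_ne_zero_of_mem_unitBall
        (mul_conj_mem_unitBall hz.1 (mem_ball_zero_iff.1 hwb))))
    have e : ∀ v, discKernel (z.1 * conj w) * discKernel (z.2 * conj v) * f (w, v) =
        discKernel (z.1 * conj w) * (f (w, v) * discKernel (z.2 * conj v)) := fun v => by ring
    simp only [e] at hw ⊢
    rw [integral_const_mul, hsw ((integrable_const_mul_iff hk.isUnit _).1 hw)]
    ring
  have h1 := hint.integral_prod_left.congr hae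
  refine ⟨(integrable_const_mul_iff hpi.isUnit _).1 h1, ?_⟩
  rw [sesquiIntegral, puncturedBidiscMeasure_eq_prod, integral_prod _ hint, integral_congr_ae hae,
    integral_const_mul]
  field_simp

/-- The reproducing property of the Bergman kernel for `A²(𝔻* × 𝔻)`. -/
theorem sesquiIntegral_eq_self {g : ℂ × ℂ → ℂ} (hg : DifferentiableOn ℂ g puncturedBidisc)
    (h2 : MemLp g 2 puncturedBidiscMeasure) {z : ℂ × ℂ} (hz : z ∈ puncturedBidisc) :
    sesquiIntegral discKernel discKernel g z = g z := by
  have hpi : (Real.pi : ℂ) ≠ 0 := by exact_mod_cast Real.pi_ne_zero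
  obtain ⟨hi, he⟩ := sesquiIntegral_iterated (h2.integrable one_le_two) hz.2
    (s := fun w => g (w, z.2)) (by
      filter_upwards [ae_mem_punctured_unitDisc] with w hw hw'
      refine disc_bergman_reproducing (g := fun v => g (w, v)) (hg.comp (by fun_prop) fun v hv => ?_)
        hz.2.2 hw'
      rw [coe_puncturedBidisc]
      exact ⟨hw, hv⟩)
  -- The slice in the first variable is holomorphic only on the punctured disc, so it is extended
  -- before the reproducing formula is applied.
  obtain ⟨F, hF, hFg⟩ := exists_extension_of_sq_integrable (f := fun w => g (w, z.2))
    (hg.comp (by fun_prop) fun w hw => by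
      rw [coe_puncturedBidisc]
      exact ⟨hw, mem_ball_zero_iff.2 hz.2.2⟩) (lintegral_slice_sq_ne_top hg h2 hz.2.2)
  have hcongr : (fun w => g (w, z.2) * discKernel (z.1 * conj w)) =ᵐ[volume.restrict (ball 0 1)]
      fun w => F w * discKernel (z.1 * conj w) := by
    filter_upwards [ae_mem_punctured_unitDisc] with w hw
    rw [hFg w hw.2]
  rw [he, integral_congr_ae hcongr]
  have := disc_bergman_reproducing hF hz.2.1 (hi.congr hcongr)
  rw [← hFg z.1 (norm_pos_iff.1 hz.1)] at *
  simp only [discKernel]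
  rw [this]
  field_simp

/-- The Bergman projection of `|w₁|² G` is `F` if the Taylor coefficients of `G` are those of `F`
multiplied by `1 + 1 / (μ + 1)`. -/
theorem sesquiIntegral_normSq_mul {F G : ℂ × ℂ → ℂ} {a : ℕ → ℕ → ℂ} (hF : HasTaylorExpansion F a)
    (hG : HasTaylorExpansion G fun m n => (1 + 1 / ((m : ℂ) + 1)) * a m n)
    (hFd : DifferentiableOn ℂ F bidisc) (hGd : DifferentiableOn ℂ G bidisc)
    (hGi : Integrable (fun w => (‖w.1‖ : ℂ) ^ 2 * G w) puncturedBidiscMeasure) {z : ℂ × ℂ}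
    (hz : z ∈ puncturedBidisc) :
    sesquiIntegral discKernel discKernel (fun w => (‖w.1‖ : ℂ) ^ 2 * G w) z = F z := by
  have hpi : (Real.pi : ℂ) ≠ 0 := by exact_mod_cast Real.pi_ne_zero
  have hz2 : z.2 ∈ ball (0 : ℂ) 1 := mem_ball_zero_iff.2 hz.2.2
  have hmem : ∀ {w v : ℂ}, w ∈ ball (0 : ℂ) 1 → v ∈ ball (0 : ℂ) 1 → (w, v) ∈ (bidisc : Set _) :=
    fun hw hv => by rw [coe_bidisc]; exact ⟨hw, hv⟩
  obtain ⟨hi, he⟩ := sesquiIntegral_iterated hGi hz.2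
    (s := fun w => (‖w‖ : ℂ) ^ 2 * G (w, z.2)) (by
      filter_upwards [ae_restrict_mem measurableSet_ball] with w hw hw'
      refine disc_bergman_reproducing (g := fun v => (‖w‖ : ℂ) ^ 2 * G (w, v)) ?_ hz.2.2 hw'
      exact (hGd.comp (f := fun v => (w, v)) (by fun_prop) fun v hv => hmem hw hv).const_mul _)
  -- Summing over the second index first gives the slice at `z₂` as a power series in `w₁`. The
  -- multiplier depends only on the first index and so passes to the slice.
  have slice : ∀ {H : ℂ × ℂ → ℂ} {b : ℕ → ℕ → ℂ}, HasTaylorExpansion H b →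
      ∀ w ∈ ball (0 : ℂ) 1, HasSum (fun m => (∑' n, b m n * z.2 ^ n) * w ^ m) (H (w, z.2)) := by
    intro H b hH w hw
    have h := hH (w, z.2) (hmem hw hz2)
    have hs := h.summable
    have h3 := h.prod_fiberwise fun m => (hs.prod_factor m).hasSum
    have e : ∀ m n, b m n * w ^ m * z.2 ^ n = (b m n * z.2 ^ n) * w ^ m := fun m n => by ring
    simpa only [e, tsum_mul_right] using h3
  have hderiv : ∀ w ∈ ball (0 : ℂ) 1, deriv (fun u => u ^ 2 * F (u, z.2)) w =
      w * deriv (fun u => u * G (u, z.2)) w := by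
    intro w hw
    refine deriv_sq_mul_eq_of_hasSum (slice hF) ?_ hw
    intro u hu
    have h := slice hG u hu
    simpa only [mul_assoc, tsum_mul_left] using h
  rw [he]
  simp only [discKernel] at hi ⊢
  rw [disc_bergman_weighted (g := fun w => F (w, z.2)) (G := fun w => G (w, z.2))
    (hFd.comp (by fun_prop) fun w hw => hmem hw hz2)
    (hGd.comp (by fun_prop) fun w hw => hmem hw hz2) hderiv hz.2.1 (norm_pos_iff.1 hz.1) hi]
  field_simp

/-- The Bergman projection of `𝔻* × 𝔻` is the integral operator of the Bergman kernel. -/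
theorem bergmanProjection_ae_eq {f : ℂ × ℂ → ℂ} (hf : MemLp f 2 puncturedBidiscMeasure) :
    ((bergmanProjection puncturedBidisc (hf.toLp f) : Lp ℂ 2 puncturedBidiscMeasure) :
      ℂ × ℂ → ℂ) =ᵐ[puncturedBidiscMeasure] sesquiIntegral discKernel discKernel f := by
  obtain ⟨G, hG, hPG⟩ := (bergmanProjection puncturedBidisc (hf.toLp f)).2
  have hG2 : MemLp G 2 puncturedBidiscMeasure := (memLp_congr_ae hPG).1 (Lp.memLp _)
  refine hPG.trans ?_
  filter_upwards [ae_mem_puncturedBidisc] with z hz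
  rw [← sesquiIntegral_eq_self hG hG2 hz, sesquiIntegral, sesquiIntegral]
  congr 1
  obtain ⟨C, hC⟩ := exists_sesqui_kernel_bound differentiableOn_discKernel
    differentiableOn_discKernel hz.2
  have hm := aestronglyMeasurable_sesqui_kernel differentiableOn_discKernel
    differentiableOn_discKernel hz.2
  have hk : MemLp (fun w : ℂ × ℂ => conj (discKernel (z.1 * conj w.1) * discKernel (z.2 * conj w.2)))
      2 puncturedBidiscMeasure := by
    refine MemLp.of_bound (Complex.continuous_conj.comp_aestronglyMeasurable hm) C ?_
    filter_upwards [ae_mem_puncturedBidisc] with w hw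
    rw [RCLike.norm_conj]
    exact hC w hw
  have hkmem : hk.toLp _ ∈ bergmanSpace 2 puncturedBidisc := by
    refine ⟨_, ?_, hk.coeFn_toLp⟩
    have e : (fun w : ℂ × ℂ => conj (discKernel (z.1 * conj w.1) * discKernel (z.2 * conj w.2))) =
        fun w => discKernel (w.1 * conj z.1) * discKernel (w.2 * conj z.2) := by
      funext w
      simp [discKernel, mul_comm]
    rw [e]
    refine DifferentiableOn.mul ?_ ?_
    · exact differentiableOn_discKernel.comp (by fun_prop) fun w hw =>
        mul_conj_mem_unitBall hw.2.1 hz.2.1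
    · exact differentiableOn_discKernel.comp (by fun_prop) fun w hw =>
        mul_conj_mem_unitBall hw.2.2 hz.2.2
  -- The conjugated kernel is holomorphic in `w` and bounded, hence in `A²`; so `f` and its
  -- projection have the same integral against the kernel, and the projection `G` is already
  -- reproduced by it.
  have horth : inner ℂ (hk.toLp _) (hf.toLp f -
      (bergmanProjection puncturedBidisc (hf.toLp f) : Lp ℂ 2 puncturedBidiscMeasure)) = 0 :=
    Submodule.inner_right_of_mem_orthogonal hkmem
      (Submodule.sub_starProjection_mem_orthogonal (K := bergmanSpace 2 puncturedBidisc) _)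
  rw [inner_sub_right, sub_eq_zero, L2.inner_def, L2.inner_def] at horth
  have e1 : ∀ (u : Lp ℂ 2 puncturedBidiscMeasure) (v : ℂ × ℂ → ℂ),
      (u : ℂ × ℂ → ℂ) =ᵐ[puncturedBidiscMeasure] v →
      ∫ w, inner ℂ ((hk.toLp _ : Lp ℂ 2 puncturedBidiscMeasure) w) (u w) ∂puncturedBidiscMeasure =
      ∫ w, discKernel (z.1 * conj w.1) * discKernel (z.2 * conj w.2) * v w
        ∂puncturedBidiscMeasure := by
    intro u v huv
    refine integral_congr_ae ?_
    filter_upwards [huv, hk.coeFn_toLp] with w hw1 hw2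
    rw [hw1, hw2, RCLike.inner_apply, Complex.conj_conj, mul_comm]
  rw [e1 _ _ hf.coeFn_toLp, e1 _ _ hPG] at horth
  exact horth.symm

/-! ### Operators between the function spaces -/

theorem sesquiIntegral_congr_ae {φ ψ : ℂ → ℂ} {f g : ℂ × ℂ → ℂ}
    (h : f =ᵐ[puncturedBidiscMeasure] g) : sesquiIntegral φ ψ f = sesquiIntegral φ ψ g := by
  funext z
  rw [sesquiIntegral, sesquiIntegral]
  congr 1
  refine integral_congr_ae ?_
  filter_upwards [h] with w hw
  rw [hw]

theorem two_le_ofReal {p : ℝ} (hp : 2 ≤ p) : 2 ≤ ENNReal.ofReal p := by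
  rw [show (2 : ℝ≥0∞) = ENNReal.ofReal 2 by simp]
  exact ENNReal.ofReal_le_ofReal hp

/-- An operator with kernel dominated by the Bergman kernel, as a bounded operator from
`L^p(𝔻* × 𝔻)` to `A^p(𝔻* × 𝔻)`. -/
theorem exists_sesquiOperator {p : ℝ} [hp : Fact (2 ≤ p)] {φ : ℂ → ℂ} {M : ℝ≥0}
    (hd : DifferentiableOn ℂ φ (ball 0 1))
    (hφ : ∀ u ∈ ball (0 : ℂ) 1, ‖φ u‖ ≤ M * ‖discKernel u‖) :
    ∃ S : Lp ℂ (ENNReal.ofReal p) puncturedBidiscMeasure →L[ℂ]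
        bergmanSpace (ENNReal.ofReal p) puncturedBidisc,
      ∀ f, ((S f : Lp ℂ (ENNReal.ofReal p) puncturedBidiscMeasure) : ℂ × ℂ → ℂ)
        =ᵐ[puncturedBidiscMeasure] sesquiIntegral φ discKernel f := by
  obtain ⟨C, hC⟩ := exists_eLpNorm_sesquiIntegral_le (p := p) (by linarith [hp.out]) hφ
  have hint : ∀ f : Lp ℂ (ENNReal.ofReal p) puncturedBidiscMeasure,
      Integrable f puncturedBidiscMeasure := fun f => (Lp.memLp f).integrable Fact.out
  have hhol : ∀ f : Lp ℂ (ENNReal.ofReal p) puncturedBidiscMeasure,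
      DifferentiableOn ℂ (sesquiIntegral φ discKernel f) puncturedBidisc := fun f =>
    (differentiableOn_sesquiIntegral hd differentiableOn_discKernel (hint f)).mono
      puncturedBidisc_le_bidisc
  have hmem : ∀ f : Lp ℂ (ENNReal.ofReal p) puncturedBidiscMeasure,
      MemLp (sesquiIntegral φ discKernel f) (ENNReal.ofReal p) puncturedBidiscMeasure := fun f =>
    ⟨(hhol f).continuousOn.aestronglyMeasurable puncturedBidisc.isOpen.measurableSet,
      (hC f (Lp.aestronglyMeasurable f)).trans_lt
        (ENNReal.mul_lt_top ENNReal.coe_lt_top (Lp.eLpNorm_lt_top f))⟩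
  let S₀ : Lp ℂ (ENNReal.ofReal p) puncturedBidiscMeasure →ₗ[ℂ]
      bergmanSpace (ENNReal.ofReal p) puncturedBidisc :=
    { toFun := fun f => ⟨(hmem f).toLp _, _, hhol f, (hmem f).coeFn_toLp⟩
      map_add' := fun f g => by
        refine Subtype.ext (Lp.ext ?_)
        refine (hmem _).coeFn_toLp.trans ?_
        refine EventuallyEq.trans ?_ (Lp.coeFn_add _ _).symm
        filter_upwards [(hmem f).coeFn_toLp, (hmem g).coeFn_toLp, ae_mem_puncturedBidisc]
          with z h1 h2 hz
        rw [Pi.add_apply, h1, h2, sesquiIntegral_congr_ae (Lp.coeFn_add f g)]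
        simp only [sesquiIntegral, Pi.add_apply, mul_add]
        rw [integral_add (integrable_sesqui_kernel_mul hd differentiableOn_discKernel hz.2 (hint f))
          (integrable_sesqui_kernel_mul hd differentiableOn_discKernel hz.2 (hint g)), mul_add]
      map_smul' := fun c f => by
        refine Subtype.ext (Lp.ext ?_)
        refine (hmem _).coeFn_toLp.trans ?_
        refine EventuallyEq.trans ?_ (Lp.coeFn_smul _ _).symm
        filter_upwards [(hmem f).coeFn_toLp] with z h1
        rw [Pi.smul_apply, RingHom.id_apply, h1, sesquiIntegral_congr_ae (Lp.coeFn_smul c f)]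
        simp only [sesquiIntegral, Pi.smul_apply, smul_eq_mul, mul_left_comm _ c]
        rw [integral_const_mul, mul_left_comm] }
  refine ⟨S₀.mkContinuous C fun f => ?_, fun f => (hmem f).coeFn_toLp⟩
  change ‖(hmem f).toLp _‖ ≤ _
  rw [Lp.norm_toLp, Lp.norm_def, ← ENNReal.coe_toReal C, ← ENNReal.toReal_mul]
  exact ENNReal.toReal_mono (ENNReal.mul_ne_top ENNReal.coe_ne_top (Lp.eLpNorm_ne_top f))
    (hC f (Lp.aestronglyMeasurable f))

theorem exists_Lp_inclusion_of_le {α : Type*} [MeasurableSpace α] {μ ν : Measure α} (h : μ ≤ ν)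
    (p : ℝ≥0∞) [Fact (1 ≤ p)] :
    ∃ J : Lp ℂ p ν →L[ℂ] Lp ℂ p μ, ∀ f, (J f : α → ℂ) =ᵐ[μ] f := by
  have hmem : ∀ f : Lp ℂ p ν, MemLp f p μ := fun f => (Lp.memLp f).mono_measure h
  have hac := h.absolutelyContinuous
  let J₀ : Lp ℂ p ν →ₗ[ℂ] Lp ℂ p μ :=
    { toFun := fun f => (hmem f).toLp _
      map_add' := fun f g => by
        rw [← MemLp.toLp_add]
        exact (MemLp.toLp_eq_toLp_iff _ _).2 (hac.ae_eq (Lp.coeFn_add f g))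
      map_smul' := fun c f => by
        rw [RingHom.id_apply, ← MemLp.toLp_const_smul]
        exact (MemLp.toLp_eq_toLp_iff _ _).2 (hac.ae_eq (Lp.coeFn_smul c f)) }
  refine ⟨J₀.mkContinuous 1 fun f => ?_, fun f => (hmem f).coeFn_toLp⟩
  change ‖(hmem f).toLp _‖ ≤ _
  rw [one_mul, Lp.norm_toLp, Lp.norm_def]
  exact ENNReal.toReal_mono (Lp.eLpNorm_ne_top f) (eLpNorm_mono_measure _ h)

theorem exists_Lp_multiplication {α : Type*} [MeasurableSpace α] {μ ν : Measure α} (h : ν ≪ μ)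
    {p : ℝ≥0∞} [Fact (1 ≤ p)] {m : α → ℂ} (hm : Measurable m)
    (hmp : ∀ f : α → ℂ, AEStronglyMeasurable f μ → eLpNorm (fun w => m w * f w) p ν ≤ eLpNorm f p μ) :
    ∃ J : Lp ℂ p μ →L[ℂ] Lp ℂ p ν, ∀ f, (J f : α → ℂ) =ᵐ[ν] fun w => m w * f w := by
  have hmem : ∀ f : Lp ℂ p μ, MemLp (fun w => m w * f w) p ν := fun f =>
    ⟨hm.aestronglyMeasurable.mul ((Lp.aestronglyMeasurable f).mono_ac h),
      (hmp f (Lp.aestronglyMeasurable f)).trans_lt (Lp.eLpNorm_lt_top f)⟩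
  let J₀ : Lp ℂ p μ →ₗ[ℂ] Lp ℂ p ν :=
    { toFun := fun f => (hmem f).toLp _
      map_add' := fun f g => by
        rw [← MemLp.toLp_add]
        refine (MemLp.toLp_eq_toLp_iff _ _).2 ?_
        filter_upwards [h.ae_eq (Lp.coeFn_add f g)] with w hw
        simp only [hw, Pi.add_apply, mul_add]
      map_smul' := fun c f => by
        rw [RingHom.id_apply, ← MemLp.toLp_const_smul]
        refine (MemLp.toLp_eq_toLp_iff _ _).2 ?_
        filter_upwards [h.ae_eq (Lp.coeFn_smul c f)] with w hw
        simp only [hw, Pi.smul_apply, smul_eq_mul, mul_left_comm] }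
  refine ⟨J₀.mkContinuous 1 fun f => ?_, fun f => (hmem f).coeFn_toLp⟩
  change ‖(hmem f).toLp _‖ ≤ _
  rw [one_mul, Lp.norm_toLp, Lp.norm_def]
  exact ENNReal.toReal_mono (Lp.eLpNorm_ne_top f) (hmp f (Lp.aestronglyMeasurable f))

theorem puncturedBidiscMeasure_le_weightedVolume {ω : ℂ × ℂ → ℝ}
    (hω : ∀ w ∈ puncturedBidisc, 1 ≤ ω w) :
    puncturedBidiscMeasure ≤ weightedVolume puncturedBidisc ω := by
  have h := withDensity_mono (μ := puncturedBidiscMeasure) (f := 1)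
    (g := fun w => ENNReal.ofReal (ω w)) (by
      filter_upwards [ae_mem_puncturedBidisc] with w hw
      simpa using hω w hw)
  rwa [withDensity_one] at h

/-- The integrand acquires the factor `|w₁|^(2p) |w₁|^(2-p) = |w₁|^(p+2) ≤ 1`. -/
theorem eLpNorm_normSq_mul_le {p : ℝ} (hp : 2 ≤ p) (f : ℂ × ℂ → ℂ) :
    eLpNorm (fun w : ℂ × ℂ => (‖w.1‖ : ℂ) ^ 2 * f w) (ENNReal.ofReal p)
      (weightedVolume puncturedBidisc fun w => ‖w.1‖ ^ (2 - p)) ≤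
      eLpNorm f (ENNReal.ofReal p) puncturedBidiscMeasure := by
  have hp0 : 0 < p := by linarith
  have hne : ENNReal.ofReal p ≠ 0 := by simpa using hp0
  rw [eLpNorm_eq_lintegral_rpow_enorm_toReal hne ENNReal.ofReal_ne_top,
    eLpNorm_eq_lintegral_rpow_enorm_toReal hne ENNReal.ofReal_ne_top, ENNReal.toReal_ofReal hp0.le]
  refine ENNReal.rpow_le_rpow ?_ (by positivity)
  refine (lintegral_withDensity_le_lintegral_mul _ (by fun_prop) _).trans ?_
  refine lintegral_mono_ae ?_
  filter_upwards [ae_mem_puncturedBidisc] with w hw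
  have hw0 : 0 < ‖w.1‖ := hw.1
  rw [Pi.mul_apply, enorm_mul, ENNReal.mul_rpow_of_nonneg _ _ hp0.le, ← mul_assoc,
    ← ofReal_norm ((‖w.1‖ : ℂ) ^ 2), norm_pow, Complex.norm_real, norm_norm,
    ENNReal.ofReal_rpow_of_pos (by positivity), ← ENNReal.ofReal_mul (by positivity)]
  refine mul_le_of_le_one_left' ?_
  rw [ENNReal.ofReal_le_one, ← Real.rpow_natCast, ← Real.rpow_mul hw0.le, ← Real.rpow_add hw0]
  exact Real.rpow_le_one hw0.le hw.2.1.le (by push_cast; linarith)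

/-- A class in `A^p(𝔻* × 𝔻)`, `p ≥ 2`, is reproduced by the Bergman kernel. -/
theorem sesquiIntegral_ae_eq_self {p : ℝ≥0∞} (hp : 2 ≤ p) (f : bergmanSpace p puncturedBidisc) :
    sesquiIntegral discKernel discKernel ((f : Lp ℂ p puncturedBidiscMeasure) : ℂ × ℂ → ℂ)
      =ᵐ[puncturedBidiscMeasure] (f : Lp ℂ p puncturedBidiscMeasure) := by
  obtain ⟨F, hF, hfF⟩ := f.2
  have hF2 : MemLp F 2 puncturedBidiscMeasure :=
    ((memLp_congr_ae hfF).1 (Lp.memLp _)).mono_exponent hp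
  rw [sesquiIntegral_congr_ae hfF]
  refine EventuallyEq.trans ?_ hfF.symm
  filter_upwards [ae_mem_puncturedBidisc] with z hz
  exact sesquiIntegral_eq_self hF hF2 hz

theorem exists_Lp_equiv_of_measure_eq {α : Type*} [MeasurableSpace α] {μ ν : Measure α} (h : μ = ν)
    (p : ℝ≥0∞) [Fact (1 ≤ p)] :
    ∃ e : Lp ℂ p μ ≃ₗᵢ[ℂ] Lp ℂ p ν, ∀ f, (e f : α → ℂ) =ᵐ[ν] f := by
  subst h
  exact ⟨LinearIsometryEquiv.refl ℂ _, fun f => EventuallyEq.rfl⟩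

/-- Restriction is an isometric isomorphism of `A^p(𝔻²)` onto `A^p(𝔻* × 𝔻)` for `p ≥ 2`. -/
theorem exists_bergmanSpace_restriction {p : ℝ≥0∞} [Fact (1 ≤ p)] (hp : 2 ≤ p) :
    ∃ Φ : bergmanSpace p bidisc ≃ₗᵢ[ℂ] bergmanSpace p puncturedBidisc,
      ∀ f : bergmanSpace p bidisc,
        ((Φ f : Lp ℂ p puncturedBidiscMeasure) : ℂ × ℂ → ℂ) =ᵐ[puncturedBidiscMeasure]
          ((f : Lp ℂ p (volume.restrict (bidisc : Set (ℂ × ℂ)))) : ℂ × ℂ → ℂ) := by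
  have hμ := puncturedBidiscMeasure_eq_restrict_bidisc
  obtain ⟨e, he⟩ := exists_Lp_equiv_of_measure_eq hμ.symm p
  have hmap : (bergmanSpace p bidisc).map (e.toLinearEquiv : _ →ₗ[ℂ] _) =
      bergmanSpace p puncturedBidisc := by
    refine le_antisymm ?_ fun g hg => ?_
    · rintro _ ⟨f, ⟨F, hF, hfF⟩, rfl⟩
      exact ⟨F, hF.mono puncturedBidisc_le_bidisc,
        (he f).trans (hμ.le.absolutelyContinuous.ae_eq hfF)⟩
    -- Surjectivity of restriction: the integral against the Bergman kernel is holomorphic on `𝔻²`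
    -- and equals `g` almost everywhere.
    · refine ⟨e.symm g, ⟨sesquiIntegral discKernel discKernel g,
        differentiableOn_sesquiIntegral differentiableOn_discKernel differentiableOn_discKernel
          ((Lp.memLp g).integrable Fact.out), ?_⟩, e.apply_symm_apply g⟩
      have h1 := he (e.symm g)
      rw [e.apply_symm_apply] at h1
      exact hμ.ge.absolutelyContinuous.ae_eq
        (h1.symm.trans (sesquiIntegral_ae_eq_self hp ⟨g, hg⟩).symm)
  exact ⟨{ e.toLinearEquiv.ofSubmodules _ _ hmap with norm_map' := fun f => e.norm_map f },
    fun f => he f⟩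

/-! ### Assembly of the proposition -/

theorem proposition3p1 (p : ℝ) [Fact (2 ≤ p)] :
    ∃ (B : weightedLp (ENNReal.ofReal p) puncturedBidisc (fun w => ‖w.1‖ ^ (2 - p)) →L[ℂ]
          bergmanSpace (ENNReal.ofReal p) puncturedBidisc)
      (Φ : bergmanSpace (ENNReal.ofReal p) bidisc ≃ₗᵢ[ℂ]
          bergmanSpace (ENNReal.ofReal p) puncturedBidisc)
      (T : bergmanSpace (ENNReal.ofReal p) bidisc →L[ℂ] bergmanSpace (ENNReal.ofReal p) bidisc)
      (R : bergmanSpace (ENNReal.ofReal p) puncturedBidisc →L[ℂ]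
          weightedLp (ENNReal.ofReal p) puncturedBidisc (fun w => ‖w.1‖ ^ (2 - p))),
      -- the weighted space lies in `L²`, and `B` is the Bergman projection on it
      (∀ f : weightedLp (ENNReal.ofReal p) puncturedBidisc (fun w => ‖w.1‖ ^ (2 - p)),
        ∃ hf : MemLp (f : ℂ × ℂ → ℂ) 2 (volume.restrict (puncturedBidisc : Set (ℂ × ℂ))),
          ((B f : Lp ℂ (ENNReal.ofReal p) (volume.restrict (puncturedBidisc : Set (ℂ × ℂ)))) :
              ℂ × ℂ → ℂ) =ᵐ[volume.restrict (puncturedBidisc : Set (ℂ × ℂ))]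
            ((bergmanProjection puncturedBidisc (hf.toLp f) :
              Lp ℂ 2 (volume.restrict (puncturedBidisc : Set (ℂ × ℂ)))) : ℂ × ℂ → ℂ)) ∧
      Function.Surjective B ∧
      -- `Φ`, the identification of `A^p(𝔻²)` with `A^p(𝔻* × 𝔻)`, is restriction
      (∀ f : bergmanSpace (ENNReal.ofReal p) bidisc,
        ((Φ f : Lp ℂ (ENNReal.ofReal p) (volume.restrict (puncturedBidisc : Set (ℂ × ℂ)))) :
            ℂ × ℂ → ℂ) =ᵐ[volume.restrict (puncturedBidisc : Set (ℂ × ℂ))]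
          ((f : Lp ℂ (ENNReal.ofReal p) (volume.restrict (bidisc : Set (ℂ × ℂ)))) : ℂ × ℂ → ℂ)) ∧
      -- `T` multiplies the Taylor coefficients by `1 + 1 / (μ + 1)`
      (∀ f : bergmanSpace (ENNReal.ofReal p) bidisc,
        ∃ (F G : ℂ × ℂ → ℂ) (a : ℕ → ℕ → ℂ),
          HasTaylorExpansion F a ∧
          HasTaylorExpansion G (fun μ ν => (1 + 1 / ((μ : ℂ) + 1)) * a μ ν) ∧
          ((f : Lp ℂ (ENNReal.ofReal p) (volume.restrict (bidisc : Set (ℂ × ℂ)))) : ℂ × ℂ → ℂ)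
            =ᵐ[volume.restrict (bidisc : Set (ℂ × ℂ))] F ∧
          ((T f : Lp ℂ (ENNReal.ofReal p) (volume.restrict (bidisc : Set (ℂ × ℂ)))) : ℂ × ℂ → ℂ)
            =ᵐ[volume.restrict (bidisc : Set (ℂ × ℂ))] G) ∧
      -- `R f = |w₁|² · T f` is a right inverse of `B`
      (∀ f : bergmanSpace (ENNReal.ofReal p) bidisc,
        (R (Φ f) : ℂ × ℂ → ℂ) =ᵐ[volume.restrict (puncturedBidisc : Set (ℂ × ℂ))]
          fun w => (‖w.1‖ : ℂ) ^ 2 *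
            ((T f : Lp ℂ (ENNReal.ofReal p) (volume.restrict (bidisc : Set (ℂ × ℂ)))) :
              ℂ × ℂ → ℂ) w) ∧
      (∀ f : bergmanSpace (ENNReal.ofReal p) puncturedBidisc, B (R f) = f) := by
  have hp : 2 ≤ p := Fact.out
  have hp2 := two_le_ofReal hp
  have hle : puncturedBidiscMeasure ≤ weightedVolume puncturedBidisc fun w => ‖w.1‖ ^ (2 - p) :=
    puncturedBidiscMeasure_le_weightedVolume fun w hw =>
      Real.one_le_rpow_of_pos_of_le_one_of_nonpos hw.1 hw.2.1.le (by linarith)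
  have hac := hle.absolutelyContinuous
  -- `S` is the Bergman projection acting on `L^p`; `S'` below is the multiplier operator `T` seen
  -- on `𝔻* × 𝔻`.
  obtain ⟨S, hS⟩ := exists_sesquiOperator (p := p) (M := 1) differentiableOn_discKernel (by simp)
  obtain ⟨S', hS'⟩ := exists_sesquiOperator (p := p) (M := 3) differentiableOn_multiplierKernel
    fun u hu => by simpa using norm_multiplierKernel_le hu
  obtain ⟨J, hJ⟩ := exists_Lp_inclusion_of_le hle (ENNReal.ofReal p)
  obtain ⟨N, hN⟩ := exists_Lp_multiplication (p := ENNReal.ofReal p)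
    (ν := weightedVolume puncturedBidisc fun w => ‖w.1‖ ^ (2 - p))
    (m := fun w : ℂ × ℂ => (‖w.1‖ : ℂ) ^ 2) (withDensity_absolutelyContinuous
      puncturedBidiscMeasure fun w => ENNReal.ofReal (‖w.1‖ ^ (2 - p))) (by fun_prop)
    fun f _ => eLpNorm_normSq_mul_le hp f
  obtain ⟨Φ, hΦ⟩ := exists_bergmanSpace_restriction hp2
  have hμ := puncturedBidiscMeasure_eq_restrict_bidisc
  have taylor : ∀ f : bergmanSpace (ENNReal.ofReal p) puncturedBidisc, ∃ a : ℕ → ℕ → ℂ,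
      HasTaylorExpansion (sesquiIntegral discKernel discKernel
        (f : Lp ℂ (ENNReal.ofReal p) puncturedBidiscMeasure)) a ∧
      HasTaylorExpansion (sesquiIntegral multiplierKernel discKernel
        (f : Lp ℂ (ENNReal.ofReal p) puncturedBidiscMeasure))
        fun m n => (1 + 1 / ((m : ℂ) + 1)) * a m n := by
    intro f
    have hi : Integrable (f : Lp ℂ (ENNReal.ofReal p) puncturedBidiscMeasure)
        puncturedBidiscMeasure :=
      (Lp.memLp (f : Lp ℂ (ENNReal.ofReal p) puncturedBidiscMeasure)).integrable Fact.out
    refine ⟨_, hasTaylorExpansion_sesquiIntegral (fun u hu => hasSum_discKernel hu)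
      (fun u hu => hasSum_discKernel hu) hi, ?_⟩
    have := hasTaylorExpansion_sesquiIntegral (fun u hu => hasSum_multiplierKernel hu)
      (fun u hu => hasSum_discKernel hu) hi
    simpa only [mul_assoc] using this
  have hBR : ∀ f, (S ∘L J) ((N ∘L (Submodule.subtypeL _) ∘L S' ∘L (Submodule.subtypeL _)) f) = f := by
    intro f
    have hi : Integrable (f : Lp ℂ (ENNReal.ofReal p) puncturedBidiscMeasure)
        puncturedBidiscMeasure :=
      (Lp.memLp (f : Lp ℂ (ENNReal.ofReal p) puncturedBidiscMeasure)).integrable Fact.out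
    obtain ⟨a, ha, ha'⟩ := taylor f
    refine Subtype.ext (Lp.ext ((hS _).trans ?_))
    have h1 : (J (N (S' f)) : ℂ × ℂ → ℂ) =ᵐ[puncturedBidiscMeasure] fun w =>
        (‖w.1‖ : ℂ) ^ 2 * sesquiIntegral multiplierKernel discKernel
        (f : Lp ℂ (ENNReal.ofReal p) puncturedBidiscMeasure) w := by
      filter_upwards [hJ (N (S' f)), hac.ae_eq (hN (S' f)), hS' f] with w e1 e2 e3
      rw [e1, e2, e3]
    have hint := ((Lp.memLp (J (N (S' f)))).integrable Fact.out).congr h1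
    change sesquiIntegral discKernel discKernel (J (N (S' f))) =ᵐ[_] _
    rw [sesquiIntegral_congr_ae h1]
    refine EventuallyEq.trans ?_ (sesquiIntegral_ae_eq_self hp2 f)
    filter_upwards [ae_mem_puncturedBidisc] with z hz
    exact sesquiIntegral_normSq_mul ha ha'
      (differentiableOn_sesquiIntegral differentiableOn_discKernel differentiableOn_discKernel hi)
      (differentiableOn_sesquiIntegral differentiableOn_multiplierKernel
        differentiableOn_discKernel hi) hint hz
  have hT : ∀ f, ((Φ.symm (S' (Φ f)) : Lp ℂ (ENNReal.ofReal p)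
      (volume.restrict (bidisc : Set (ℂ × ℂ)))) : ℂ × ℂ → ℂ) =ᵐ[puncturedBidiscMeasure]
      ((S' (Φ f) : Lp ℂ (ENNReal.ofReal p) puncturedBidiscMeasure) : ℂ × ℂ → ℂ) := by
    intro f
    have h1 := hΦ (Φ.symm (S' (Φ f)))
    rw [Φ.apply_symm_apply] at h1
    exact h1.symm
  -- `T` is `S'` conjugated by the restriction `Φ`, and the right inverse `R` is `|w₁|²` times `S'`.
  -- Surjectivity is read off from `hBR`.
  refine ⟨S ∘L J, Φ, Φ.symm.toLinearIsometry.toContinuousLinearMap ∘L S' ∘L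
    (Submodule.subtypeL _) ∘L Φ.toLinearIsometry.toContinuousLinearMap,
    N ∘L (Submodule.subtypeL _) ∘L S' ∘L (Submodule.subtypeL _), fun f => ?_,
    fun f => ⟨_, hBR f⟩, hΦ, fun f => ?_, fun f => ?_, hBR⟩
  · have hf : MemLp (f : ℂ × ℂ → ℂ) 2 puncturedBidiscMeasure :=
      ((Lp.memLp f).mono_measure hle).mono_exponent hp2
    refine ⟨hf, (hS (J f)).trans ?_⟩
    rw [sesquiIntegral_congr_ae (hJ f)]
    exact (bergmanProjection_ae_eq hf).symm
  · obtain ⟨a, ha, ha'⟩ := taylor (Φ f)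
    refine ⟨_, _, a, ha, ha', ?_, ?_⟩
    · exact hμ.ge.absolutelyContinuous.ae_eq
        ((hΦ f).symm.trans (sesquiIntegral_ae_eq_self hp2 (Φ f)).symm)
    · exact hμ.ge.absolutelyContinuous.ae_eq ((hT f).trans (hS' (Φ f)))
  · filter_upwards [hac.ae_eq (hN (S' (Φ f))), hT f] with w h1 h2
    exact h1.trans (congrArg _ h2.symm)
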